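/- Fix $K\ge 0$, $h=(h_0,\dots,h_K)\in\mathbb R^{K+1}$, $\sigma>0$ and $P_X>0$. Consider the Gaussian intersymbol interference channel $$y_t=\sum_{i=0}^{K}h_i x_{t-i}+w_t,\qquad t=1,\dots,n,$$ where $x_t=0$ for $t\le 0$ and $w_1,\dots,w_n$ are i.i.d. $\mathcal N(0,\sigma^2)$, independent of the input. A code with codewords $x_1,\dots,x_M\in\mathbb R^n$ (equiprobable messages) is decoded by the universal memoryless decoder (the GLRT) $$\hat\imath=\arg\max_{1\le i\le M}\Bigl|\sum_{t=1}^n x_{i,t}\,y_t\Bigr|,$$ ties being counted as errors, and $P_e$ denotes the resulting average error probability. A rate $R$ (in nats per channel use) is called achievable with this decoder if for every $\delta>0$ there are codes $\mathfrak C_n\subset\mathbb R^n$ of sizes $M_n\ge e^{n(R-\delta)}$, whose codewords all satisfy $\sum_{t=1}^n x_t^2\le nP_X$, with $P_e(\mathfrak C_n)\to 0$ as $n\to\infty$. Then every real $$R<\frac12\log\left(1+\frac{h_0^2P_X}{(\|h\|_2^2-h_0^2)P_X+\sigma^2}\right)$$ is achievable with this decoder. Moreover, this is attained by random coding: if $\lceil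 e^{nR}\rceil$ codewords are drawn independently and uniformly from the power shell $\{x\in\mathbb R^n:\ |\frac1n\sum_{t=1}^n x_t^2-P_X|<\varepsilon\}$, for any fixed $\varepsilon>0$, or independently and uniformly from the sphere of radius $\sqrt{nP_X}$ in $\mathbb R^n$, then the expectation of $P_e$ over the random code tends to $0$ as $n\to\infty$. -/

import Mathlib

open MeasureTheory ProbabilityTheory Filter Topology
open scoped ENNReal NNReal

namespace GaussianISI

noncomputable section

/-- Noiseless output `∑_{i=0}^{K} h_i x_{t-i}` of the ISI filter for a block of length `n`, where
the inputs before the start of the block are zero. (Times run over `0, …, n-1`.) -/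
def filterOutput {K n : ℕ} (h : Fin (K + 1) → ℝ) (x : Fin n → ℝ) (t : Fin n) : ℝ :=
  ∑ i : Fin (K + 1),
    h i * (if (i : ℕ) ≤ (t : ℕ) then x ⟨(t : ℕ) - (i : ℕ), (Nat.sub_le _ _).trans_lt t.isLt⟩ else 0)

/-- White Gaussian noise of length `n`: i.i.d. components of law `N(0, σ²)`. -/
def noise (n : ℕ) (σ : ℝ) : Measure (Fin n → ℝ) :=
  Measure.pi fun _ => gaussianReal 0 (σ ^ 2).toNNReal

/-- The channel: law of the output `y_t = ∑_{i=0}^{K} h_i x_{t-i} + w_t` for the input block `x`. -/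
def channel {K n : ℕ} (h : Fin (K + 1) → ℝ) (σ : ℝ) (x : Fin n → ℝ) : Measure (Fin n → ℝ) :=
  (noise n σ).map fun w t => filterOutput h x t + w t

/-- Metric of the universal memoryless decoder: the absolute empirical correlation of the codeword
`x` with the received word `y`. The decoder picks a codeword of maximal metric. -/
def glrtMetric {n : ℕ} (x y : Fin n → ℝ) : ℝ :=
  |∑ t, x t * y t|

/-- Received words for which the maximum absolute correlation decoder may fail to output the message
`i`: some other codeword has at least the same metric (ties are counted as errors). -/
def errorEvent {n M : ℕ} (C : Fin M → Fin n → ℝ) (i : Fin M) : Set (Fin n → ℝ) :=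
  {y | ∃ j, j ≠ i ∧ glrtMetric (C i) y ≤ glrtMetric (C j) y}

/-- Error probability of the code `C` over the ISI channel, with equiprobable messages, under
maximum absolute correlation decoding. -/
def errorProb {K n M : ℕ} (h : Fin (K + 1) → ℝ) (σ : ℝ) (C : Fin M → Fin n → ℝ) : ℝ≥0∞ :=
  (M : ℝ≥0∞)⁻¹ * ∑ i, channel h σ (C i) (errorEvent C i)

/-- `R` (in nats per channel use) is achievable over the ISI channel with the maximum absolute
correlation decoder, under the power constraint `P`. -/
def IsAchievable {K : ℕ} (h : Fin (K + 1) → ℝ) (σ P R : ℝ) : Prop :=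
  ∀ δ : ℝ, 0 < δ → ∃ (M : ℕ → ℕ) (C : ∀ n, Fin (M n) → Fin n → ℝ),
    (∀ n : ℕ, Real.exp (n * (R - δ)) ≤ M n) ∧
    (∀ (n : ℕ) (i : Fin (M n)), ∑ t, C n i t ^ 2 ≤ n * P) ∧
    Tendsto (fun n => errorProb h σ (C n)) atTop (𝓝 0)

/-- The power shell: words whose empirical power is within `ε` of `P`. -/
def powerShell (n : ℕ) (P ε : ℝ) : Set (Fin n → ℝ) :=
  {x | |(1 / (n : ℝ)) * ∑ t, x t ^ 2 - P| < ε}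

/-- Uniform distribution (normalized Lebesgue measure) on the power shell. -/
def uniformShell (n : ℕ) (P ε : ℝ) : Measure (Fin n → ℝ) :=
  ProbabilityTheory.cond volume (powerShell n P ε)

/-- Uniform distribution on the sphere of radius `√(nP)` in `ℝⁿ`: the normalized surface measure of
the Euclidean unit sphere, scaled by `√(nP)`. -/
def uniformSphere (n : ℕ) (P : ℝ) : Measure (Fin n → ℝ) :=
  (ProbabilityTheory.cond (volume : Measure (EuclideanSpace ℝ (Fin n))).toSphere Set.univ).map
    fun (u : Metric.sphere (0 : EuclideanSpace ℝ (Fin n)) 1) t => √(n * P) * u.1 t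

/-- Ensemble average error probability of a code of `M` codewords drawn independently from `μ`. -/
def avgErrorProb {K n : ℕ} (h : Fin (K + 1) → ℝ) (σ : ℝ) (M : ℕ) (μ : Measure (Fin n → ℝ)) :
    ℝ≥0∞ :=
  ∫⁻ C : Fin M → Fin n → ℝ, errorProb h σ C ∂(Measure.pi fun _ => μ)

end

end GaussianISI

/-! Draw the codewords independently from a law symmetric under permutations and sign changes of the
coordinates, with empirical power close to Q. Let `x` be the transmitted word and `y` the output.
Sign symmetry makes distinct delays of `x` nearly orthogonal, so ⟨x, y⟩/n tends to h₀Q and ‖y‖²/n to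
‖h‖²Q + σ² in probability (`tendstoInProb_correlation`, `tendstoInProb_output_energy`). Hence the
squared cosine between `x` and `y` tends to ρ² = h₀²Q/(‖h‖²Q + σ²).

A wrong codeword is independent of `y`. For every fixed direction, a uniform word lies in the pair
of opposite caps of cosine at least c with probability at most a constant times (1 - c'²)^(n/2), for
each c' < c. This rests on the fact that a cap of a ball fits into a ball smaller by the factor √(1
- c²) (`cap_subset`, `volume_cap_le`). With a threshold just below ρ, the sent word passes with
probability tending to one, and the union bound over e^{nR} competitors vanishes as soon as e^{2R}(1
- ρ²) < 1 (`avgErrorProb_le`). As 1/(1 - ρ²) is one plus the ratio of h₀²Q to (‖h‖² - h₀²)Q + σ²,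
this is the claimed rate at power Q.

`IsCodingEnsemble` isolates what is needed of the random words. The sphere satisfies it with Q = P.
The shell satisfies it with Q = P + ε, because its volume concentrates at the outer boundary; this
suffices since the rate bound increases with the power. Achievability follows by picking a good code
from the sphere ensemble. -/

namespace GaussianISI

/-! ### Convergence in probability along varying probability spaces. -/

section TendstoInProb

variable {Ω : ℕ → Type*} [∀ n, MeasurableSpace (Ω n)]

/-- Convergence in probability to a constant of real random variables that live on a sequence of
possibly different measure spaces. -/
def TendstoInProb (ν : ∀ n, Measure (Ω n)) (f : ∀ n, Ω n → ℝ) (a : ℝ) : Prop :=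
  ∀ η : ℝ, 0 < η → Tendsto (fun n => ν n {ω | η ≤ |f n ω - a|}) atTop (𝓝 0)

variable {ν : ∀ n, Measure (Ω n)} {f g : ∀ n, Ω n → ℝ} {a b : ℝ}

theorem tendsto_zero_of_eventually_le {u v : ℕ → ℝ≥0∞} (hv : Tendsto v atTop (𝓝 0))
    (huv : ∀ᶠ n in atTop, u n ≤ v n) : Tendsto u atTop (𝓝 0) :=
  tendsto_of_tendsto_of_tendsto_of_le_of_le' tendsto_const_nhds hv
    (Eventually.of_forall fun _ => zero_le) huv

theorem TendstoInProb.add (hf : TendstoInProb ν f a) (hg : TendstoInProb ν g b) :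
    TendstoInProb ν (fun n ω => f n ω + g n ω) (a + b) := by
  intro η hη
  have h := (hf (η / 2) (half_pos hη)).add (hg (η / 2) (half_pos hη))
  rw [add_zero] at h
  refine tendsto_zero_of_eventually_le h (Eventually.of_forall fun n => ?_)
  refine (measure_mono ?_).trans (measure_union_le _ _)
  intro ω hω
  simp only [Set.mem_ofPred_eq, Set.mem_union] at hω ⊢
  by_contra! hc
  have := abs_add_le (f n ω - a) (g n ω - b)
  rw [show f n ω + g n ω - (a + b) = (f n ω - a) + (g n ω - b) by ring] at hω
  linarith

theorem tendstoInProb_const (c : ℝ) : TendstoInProb ν (fun _ _ => c) c := by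
  intro η hη
  simp [not_le.2 hη]

theorem TendstoInProb.const_mul (c : ℝ) (hf : TendstoInProb ν f a) :
    TendstoInProb ν (fun n ω => c * f n ω) (c * a) := by
  rcases eq_or_ne c 0 with rfl | hc
  · simpa using tendstoInProb_const (ν := ν) 0
  intro η hη
  have hc' := abs_pos.2 hc
  refine tendsto_zero_of_eventually_le (hf (η / |c|) (by positivity))
    (Eventually.of_forall fun n => measure_mono fun ω hω => ?_)
  simp only [Set.mem_ofPred_eq] at hω ⊢
  rw [← mul_sub, abs_mul] at hω
  rwa [div_le_iff₀' hc']

theorem TendstoInProb.sum {ι : Type*} (s : Finset ι) {f : ι → ∀ n, Ω n → ℝ} {a : ι → ℝ}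
    (hf : ∀ i ∈ s, TendstoInProb ν (f i) (a i)) :
    TendstoInProb ν (fun n ω => ∑ i ∈ s, f i n ω) (∑ i ∈ s, a i) := by
  classical
  induction s using Finset.induction_on with
  | empty => simpa using tendstoInProb_const (ν := ν) 0
  | insert i s his ih =>
    simp only [Finset.sum_insert his]
    exact (hf i (by simp)).add (ih fun j hj => hf j (by simp [hj]))

/-- The form in which Chebyshev, Markov and volume bounds enter; the bound is asked only for large
`n`, since the ensembles are well behaved only there. -/
theorem TendstoInProb.of_le (u : ℝ → ℕ → ℝ)
    (hu : ∀ η, 0 < η → Tendsto (u η) atTop (𝓝 0))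
    (h : ∀ η, 0 < η → ∀ᶠ n in atTop, ν n {ω | η ≤ |f n ω - a|} ≤ ENNReal.ofReal (u η n)) :
    TendstoInProb ν f a := by
  intro η hη
  refine tendsto_zero_of_eventually_le ?_ (h η hη)
  simpa [Function.comp_def] using (ENNReal.continuous_ofReal.tendsto 0).comp (hu η hη)

theorem TendstoInProb.congr (hf : TendstoInProb ν f a) (h : ∀ᶠ n in atTop, ∀ ω, f n ω = g n ω) :
    TendstoInProb ν g a := by
  intro η hη
  refine (hf η hη).congr' ?_
  filter_upwards [h] with n hn
  simp [hn]

/-- Continuous mapping for two variables: a neighbourhood of the limit is hit with probability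
tending to one. -/
theorem TendstoInProb.measure_compl_tendsto (hf : TendstoInProb ν f a) (hg : TendstoInProb ν g b)
    {U : Set (ℝ × ℝ)} (hU : U ∈ 𝓝 (a, b)) :
    Tendsto (fun n => ν n {ω | (f n ω, g n ω) ∉ U}) atTop (𝓝 0) := by
  obtain ⟨η, hη, hball⟩ := Metric.mem_nhds_iff.1 hU
  have h := (hf η hη).add (hg η hη)
  rw [add_zero] at h
  refine tendsto_zero_of_eventually_le h (Eventually.of_forall fun n => ?_)
  refine (measure_mono ?_).trans (measure_union_le _ _)
  intro ω hω
  simp only [Set.mem_ofPred_eq, Set.mem_union] at hω ⊢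
  by_contra! hc
  refine hω (hball ?_)
  simp only [Metric.mem_ball, Prod.dist_eq, Real.dist_eq, sup_lt_iff]
  exact hc

end TendstoInProb

/-! ### Chebyshev bounds for the noise. -/

section Noise

instance instIsProbabilityMeasureNoise (n : ℕ) (σ : ℝ) : IsProbabilityMeasure (noise n σ) := by
  unfold noise; infer_instance

/-- Chebyshev's inequality; the coordinates are independent under the product measure, so the
variances add. -/
theorem noise_deviation_le {n : ℕ} (σ : ℝ) {g : Fin n → ℝ → ℝ}
    (hg : ∀ t, MemLp (g t) 2 (gaussianReal 0 (σ ^ 2).toNNReal)) {c : ℝ} (hc : 0 < c) :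
    noise n σ {w | c ≤ |∑ t, g t (w t) - ∑ t, ∫ x, g t x ∂gaussianReal 0 (σ ^ 2).toNNReal|} ≤
      ENNReal.ofReal ((∑ t, Var[g t; gaussianReal 0 (σ ^ 2).toNNReal]) / c ^ 2) := by
  have hL : ∀ t, MemLp (fun w : Fin n → ℝ => g t (w t)) 2 (noise n σ) := fun t =>
    (hg t).comp_measurePreserving (measurePreserving_eval _ t)
  have h := meas_ge_le_variance_div_sq (μ := noise n σ)
    (X := ∑ t, fun w : Fin n → ℝ => g t (w t)) (memLp_finsetSum' _ fun t _ => hL t) hc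
  have hv : Var[∑ t, fun w : Fin n → ℝ => g t (w t); noise n σ] =
      ∑ t, Var[g t; gaussianReal 0 (σ ^ 2).toNNReal] := variance_sum_pi hg
  have hm : ∫ w, (∑ t, fun w : Fin n → ℝ => g t (w t)) w ∂noise n σ =
      ∑ t, ∫ x, g t x ∂gaussianReal 0 (σ ^ 2).toNNReal := by
    simp only [Finset.sum_apply]
    rw [integral_finsetSum _ fun t _ => (hL t).integrable (by norm_num)]
    exact Finset.sum_congr rfl fun t _ => integral_comp_eval (hg t).aestronglyMeasurable
  rw [hv, hm] at h
  simpa only [Finset.sum_apply] using h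

theorem noise_inner_deviation_le {n : ℕ} (σ : ℝ) (v : Fin n → ℝ) {c : ℝ} (hc : 0 < c) :
    noise n σ {w | c ≤ |∑ t, v t * w t|} ≤
      ENNReal.ofReal (σ ^ 2 * (∑ t, v t ^ 2) / c ^ 2) := by
  have h := noise_deviation_le σ (g := fun t x => v t * x)
    (fun t => (memLp_id_gaussianReal 2).const_mul (v t)) hc
  have hm : ∀ t, ∫ x, v t * x ∂gaussianReal 0 (σ ^ 2).toNNReal = 0 := fun t => by
    rw [integral_const_mul, integral_id_gaussianReal, mul_zero]
  have hv : ∀ t, Var[fun x => v t * x; gaussianReal 0 (σ ^ 2).toNNReal] = σ ^ 2 * v t ^ 2 :=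
    fun t => by
      rw [variance_const_mul, variance_fun_id_gaussianReal, Real.coe_toNNReal _ (sq_nonneg σ),
        mul_comm]
  simpa only [hm, hv, Finset.sum_const_zero, sub_zero, ← Finset.mul_sum] using h

theorem noise_sq_deviation_le {n : ℕ} (σ : ℝ) {c : ℝ} (hc : 0 < c) :
    noise n σ {w | c ≤ |∑ t, w t ^ 2 - n * σ ^ 2|} ≤
      ENNReal.ofReal (n * Var[fun x => x ^ 2; gaussianReal 0 (σ ^ 2).toNNReal] / c ^ 2) := by
  have hL : MemLp (fun x : ℝ => x ^ 2) 2 (gaussianReal 0 (σ ^ 2).toNNReal) := by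
    -- The square is in L² because the Gaussian has a fourth moment: Hölder with 1/4 + 1/4 = 1/2.
    have h4 : MemLp (id : ℝ → ℝ) 4 (gaussianReal 0 (σ ^ 2).toNNReal) :=
      memLp_id_gaussianReal' 4 (by simp)
    have := h4.mul h4 (r := 2) (hpqr := ⟨by
      rw [← two_mul, show (4 : ℝ≥0∞) = 2 * 2 by norm_num, ENNReal.mul_inv (by simp) (by simp),
        ← mul_assoc, ENNReal.mul_inv_cancel (by simp) (by simp), one_mul]⟩)
    refine this.ae_eq (Eventually.of_forall fun x => ?_)
    simp [sq]
  have h := noise_deviation_le (n := n) σ (g := fun _ x => x ^ 2) (fun _ => hL) hc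
  have hm : ∫ x, x ^ 2 ∂gaussianReal 0 (σ ^ 2).toNNReal = σ ^ 2 := by
    have h1 := variance_fun_id_gaussianReal (μ := 0) (v := (σ ^ 2).toNNReal)
    rw [variance_eq_integral (by fun_prop)] at h1
    simp only [integral_id_gaussianReal, sub_zero] at h1
    rw [h1, Real.coe_toNNReal _ (sq_nonneg σ)]
  simpa [hm] using h

end Noise

/-! ### Delays, and moments of symmetric ensembles. -/

theorem integral_comp_of_measurePreserving {α : Type*} [MeasurableSpace α] {μ : Measure α}
    {φ : α → α} (hφ : MeasurePreserving φ μ μ) {f : α → ℝ} (hf : Measurable f) :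
    ∫ x, f (φ x) ∂μ = ∫ x, f x ∂μ := by
  conv_rhs => rw [← hφ.map_eq]
  rw [integral_map hφ.measurable.aemeasurable hf.aestronglyMeasurable]

/-- The input block delayed by `i` samples, with zeros before the start of the block. -/
def delay {n : ℕ} (i : ℕ) (x : Fin n → ℝ) (t : Fin n) : ℝ :=
  if i ≤ (t : ℕ) then x ⟨(t : ℕ) - i, (Nat.sub_le _ _).trans_lt t.isLt⟩ else 0

theorem delay_zero {n : ℕ} (x : Fin n → ℝ) : delay 0 x = x := by
  ext t; simp [delay]

theorem filterOutput_eq {K n : ℕ} (h : Fin (K + 1) → ℝ) (x : Fin n → ℝ) (t : Fin n) :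
    filterOutput h x t = ∑ i : Fin (K + 1), h i * delay i x t := rfl

@[fun_prop]
theorem measurable_delay {n : ℕ} (i : ℕ) (t : Fin n) :
    Measurable fun x : Fin n → ℝ => delay i x t := by
  unfold delay
  split_ifs <;> fun_prop

/-- The energy lost by a delay is that of the last `i` samples. -/
theorem sum_sq_sub_sum_delay_sq {n : ℕ} (i : ℕ) (x : Fin n → ℝ) :
    ∑ t, x t ^ 2 - ∑ t, delay i x t ^ 2 = ∑ t with n ≤ (t : Fin n).1 + i, x t ^ 2 := by
  have h : ∑ t, delay i x t ^ 2 = ∑ t with ¬ n ≤ (t : Fin n).1 + i, x t ^ 2 := by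
    have h0 : ∑ t, delay i x t ^ 2 = ∑ t with i ≤ (t : Fin n).1, delay i x t ^ 2 := by
      rw [Finset.sum_filter]
      refine Finset.sum_congr rfl fun t _ => ?_
      simp only [delay]; split_ifs <;> simp
    rw [h0]
    refine Finset.sum_bij' (fun t _ => ⟨t.1 - i, (Nat.sub_le _ _).trans_lt t.isLt⟩)
      (fun t ht => ⟨t.1 + i, by simpa using ht⟩) ?_ ?_ ?_ ?_ ?_
    · intro t ht
      simp only [Finset.mem_filter, Finset.mem_univ, true_and] at ht ⊢
      omega
    · intro t ht
      simp
    · intro t ht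
      simp only [Finset.mem_filter, Finset.mem_univ, true_and] at ht
      ext; simp; omega
    · intro t ht
      ext; simp
    · intro t ht
      simp only [Finset.mem_filter, Finset.mem_univ, true_and] at ht
      simp [delay, ht]
  rw [h, ← Finset.sum_filter_add_sum_filter_not Finset.univ (fun t : Fin n => n ≤ t.1 + i)]
  ring

theorem sum_delay_sq_le {n : ℕ} (i : ℕ) (x : Fin n → ℝ) :
    ∑ t, delay i x t ^ 2 ≤ ∑ t, x t ^ 2 := by
  have : 0 ≤ ∑ t with n ≤ (t : Fin n).1 + i, x t ^ 2 := Finset.sum_nonneg fun _ _ => sq_nonneg _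
  linarith [sum_sq_sub_sum_delay_sq i x]

/-- A random word of length `n` whose law is invariant under permutations and sign changes of the
coordinates, and whose empirical power is at most `Q`. -/
structure IsSymmetricEnsemble {n : ℕ} (μ : Measure (Fin n → ℝ)) (Q : ℝ) : Prop where
  isProbabilityMeasure : IsProbabilityMeasure μ
  perm : ∀ e : Equiv.Perm (Fin n), MeasurePreserving (fun x t => x (e t)) μ μ
  flip : ∀ a : Fin n, MeasurePreserving (fun x => Function.update x a (-x a)) μ μ
  power_le : ∀ᵐ x ∂μ, ∑ t, x t ^ 2 ≤ n * Q

namespace IsSymmetricEnsemble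

variable {n : ℕ} {μ : Measure (Fin n → ℝ)} {Q : ℝ}

theorem abs_delay_le (hμ : IsSymmetricEnsemble μ Q) :
    ∀ᵐ x ∂μ, ∀ (i : ℕ) (t : Fin n), |delay i x t| ≤ √(n * Q) := by
  filter_upwards [hμ.power_le] with x hx i t
  unfold delay
  split_ifs with h
  · refine Real.abs_le_sqrt (le_trans ?_ hx)
    exact Finset.single_le_sum (f := fun t => x t ^ 2) (fun _ _ => sq_nonneg _) (Finset.mem_univ _)
  · rw [abs_zero]
    positivity

theorem integrable_delay_mul (hμ : IsSymmetricEnsemble μ Q) (i j k l : ℕ) (t s u v : Fin n) :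
    Integrable (fun x => delay i x t * delay j x s * (delay k x u * delay l x v)) μ := by
  have := hμ.isProbabilityMeasure
  refine Integrable.of_bound (by fun_prop) (√(n * Q) * √(n * Q) * (√(n * Q) * √(n * Q))) ?_
  filter_upwards [hμ.abs_delay_le] with x hx
  simp only [norm_mul, Real.norm_eq_abs]
  gcongr <;> exact hx _ _

theorem integrable_mul (hμ : IsSymmetricEnsemble μ Q) (a b : Fin n) :
    Integrable (fun x => x a ^ 2 * x b ^ 2) μ := by
  simpa [delay_zero, sq] using hμ.integrable_delay_mul 0 0 0 0 a a b b

theorem integrable_sq (hμ : IsSymmetricEnsemble μ Q) (a : Fin n) :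
    Integrable (fun x => x a ^ 2) μ := by
  have := hμ.isProbabilityMeasure
  refine Integrable.of_bound (Measurable.aestronglyMeasurable (by fun_prop)) (√(n * Q) ^ 2) ?_
  filter_upwards [hμ.abs_delay_le] with x hx
  have := hx 0 a
  rw [delay_zero] at this
  simp only [norm_pow, Real.norm_eq_abs]
  gcongr

/-- Permutations make the `n` second moments equal, and their sum is at most `n * Q`. -/
theorem integral_sq_le (hμ : IsSymmetricEnsemble μ Q) (a : Fin n) :
    ∫ x, x a ^ 2 ∂μ ≤ Q := by
  have := hμ.isProbabilityMeasure
  have hn : 0 < (n : ℝ) := by exact_mod_cast a.pos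
  have heq : ∀ b : Fin n, ∫ x, x b ^ 2 ∂μ = ∫ x, x a ^ 2 ∂μ := fun b => by
    have := integral_comp_of_measurePreserving (hμ.perm (Equiv.swap a b))
      (f := fun x => x a ^ 2) (by fun_prop)
    simpa using this
  have hsum : ∑ b : Fin n, ∫ x, x b ^ 2 ∂μ ≤ n * Q := by
    rw [← integral_finsetSum _ fun b _ => hμ.integrable_sq b]
    calc _ ≤ ∫ _, (n * Q : ℝ) ∂μ := integral_mono_ae
            (integrable_finsetSum _ fun b _ => hμ.integrable_sq b) (integrable_const _) hμ.power_le
      _ = n * Q := by simp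
  simp only [heq, Finset.sum_const, Finset.card_univ, Fintype.card_fin, nsmul_eq_mul] at hsum
  exact le_of_mul_le_mul_left hsum hn

/-- Swaps fixing `a` make the mean of x_a² x_c² the same for all `n - 1` indices c ≠ a, while their
sum is at most the mean of x_a² times `n * Q`. -/
theorem integral_sq_mul_sq_le (hμ : IsSymmetricEnsemble μ Q) (hQ : 0 ≤ Q) {a b : Fin n}
    (hab : a ≠ b) : ((n : ℝ) - 1) * ∫ x, x a ^ 2 * x b ^ 2 ∂μ ≤ n * Q ^ 2 := by
  have := hμ.isProbabilityMeasure
  have heq : ∀ c ∈ Finset.univ.erase a, ∫ x, x a ^ 2 * x c ^ 2 ∂μ = ∫ x, x a ^ 2 * x b ^ 2 ∂μ :=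
    fun c hc => by
      have := integral_comp_of_measurePreserving (hμ.perm (Equiv.swap b c))
        (f := fun x => x a ^ 2 * x b ^ 2) (by fun_prop)
      simpa [Equiv.swap_apply_of_ne_of_ne hab (Finset.ne_of_mem_erase hc).symm] using this
  have hsum : ∑ c ∈ Finset.univ.erase a, ∫ x, x a ^ 2 * x c ^ 2 ∂μ ≤ n * Q ^ 2 := by
    rw [← integral_finsetSum _ fun b _ => hμ.integrable_mul a b]
    calc _ ≤ ∫ x, x a ^ 2 * (n * Q : ℝ) ∂μ := by
            refine integral_mono_ae (integrable_finsetSum _ fun b _ => hμ.integrable_mul a b)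
              ((hμ.integrable_sq a).mul_const _) ?_
            filter_upwards [hμ.power_le] with x hx
            rw [← Finset.mul_sum]
            refine mul_le_mul_of_nonneg_left (le_trans ?_ hx) (sq_nonneg _)
            exact Finset.sum_le_sum_of_subset_of_nonneg (Finset.erase_subset _ _)
              fun _ _ _ => sq_nonneg _
      _ = (∫ x, x a ^ 2 ∂μ) * (n * Q) := integral_mul_const _ _
      _ ≤ Q * (n * Q) := by
            have := hμ.integral_sq_le a
            gcongr
      _ = n * Q ^ 2 := by ring
  rw [Finset.sum_congr rfl heq] at hsum
  have hn : 1 ≤ n := a.pos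
  simpa [Finset.card_erase_of_mem, Nat.cast_sub hn] using hsum

/-- A correlation of two distinct delays at two distinct times vanishes in mean: the earliest of the
four samples occurs only once, and its sign is symmetric. -/
theorem integral_delay_eq_zero (hμ : IsSymmetricEnsemble μ Q) {i j : ℕ} (hij : i < j)
    {t s : Fin n} (hts : t < s) :
    ∫ x, delay i x t * delay j x t * (delay i x s * delay j x s) ∂μ = 0 := by
  by_cases hj : j ≤ (t : ℕ)
  · have h := integral_comp_of_measurePreserving
      (hμ.flip ⟨(t : ℕ) - j, (Nat.sub_le _ _).trans_lt t.isLt⟩)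
      (f := fun x => delay i x t * delay j x t * (delay i x s * delay j x s)) (by fun_prop)
    have hts' : (t : ℕ) < s := hts
    have h1 : (t : ℕ) - i ≠ t - j := by omega
    have h2 : (s : ℕ) - i ≠ t - j := by omega
    have h3 : (s : ℕ) - j ≠ t - j := by omega
    have h4 : i ≤ (t : ℕ) := by omega
    have h5 : i ≤ (s : ℕ) := by omega
    have h6 : j ≤ (s : ℕ) := by omega
    simp only [delay, hj, h4, h5, h6, if_true, Function.update_apply, Fin.mk.injEq, h1, h2, h3,
      if_false, mul_neg, neg_mul, integral_neg] at h ⊢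
    linarith
  · simp [delay, hj]

/-- Expanding the square, the off-diagonal terms vanish by sign symmetry. Only `n` diagonal terms
remain, so the second moment is of order n rather than n². -/
theorem integral_sq_autocorrelation_le (hμ : IsSymmetricEnsemble μ Q) (hQ : 0 ≤ Q) (hn : 2 ≤ n)
    {i j : ℕ} (hij : i < j) :
    ∫ x, (∑ t, delay i x t * delay j x t) ^ 2 ∂μ ≤ n * (n * Q ^ 2 / (n - 1)) := by
  have hn' : (0 : ℝ) < n - 1 := by
    have : (2 : ℝ) ≤ n := by exact_mod_cast hn
    linarith
  simp only [sq (∑ t, _), Finset.sum_mul_sum]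
  rw [integral_finsetSum _ fun t _ => integrable_finsetSum _ fun s _ =>
    hμ.integrable_delay_mul i j i j t t s s]
  have hdiag : ∀ t : Fin n, ∫ x, ∑ s, delay i x t * delay j x t * (delay i x s * delay j x s) ∂μ =
      ∫ x, delay i x t * delay j x t * (delay i x t * delay j x t) ∂μ := fun t => by
    rw [integral_finsetSum _ fun s _ => hμ.integrable_delay_mul i j i j t t s s]
    refine Finset.sum_eq_single_of_mem t (Finset.mem_univ _) fun s _ hs => ?_
    rcases lt_or_gt_of_ne hs with hs | hs
    · simp only [mul_comm (delay i _ t * delay j _ t)]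
      exact hμ.integral_delay_eq_zero hij hs
    · exact hμ.integral_delay_eq_zero hij hs
  simp only [hdiag]
  have hle : ∀ t : Fin n, ∫ x, delay i x t * delay j x t * (delay i x t * delay j x t) ∂μ ≤
      n * Q ^ 2 / (n - 1) := fun t => by
    by_cases hj : j ≤ (t : ℕ)
    · rw [le_div_iff₀ hn', mul_comm]
      have h := hμ.integral_sq_mul_sq_le hQ
        (a := ⟨(t : ℕ) - i, (Nat.sub_le _ _).trans_lt t.isLt⟩)
        (b := ⟨(t : ℕ) - j, (Nat.sub_le _ _).trans_lt t.isLt⟩)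
        (by simp only [ne_eq, Fin.mk.injEq]; omega)
      convert! h using 4 with x
      simp only [delay, hj, show i ≤ (t : ℕ) by omega, if_true]
      ring
    · simp only [delay, hj, if_false, mul_zero, integral_zero]
      positivity
  calc _ ≤ ∑ t : Fin n, (n * Q ^ 2 / (n - 1) : ℝ) := Finset.sum_le_sum fun t _ => hle t
    _ = _ := by simp

/-- At most `i` samples are pushed out of the block, each of mean energy at most `Q`. -/
theorem integral_sum_sq_sub_delay_le (hμ : IsSymmetricEnsemble μ Q) (hQ : 0 ≤ Q) (i : ℕ) :
    ∫ x, (∑ t, x t ^ 2 - ∑ t, delay i x t ^ 2) ∂μ ≤ i * Q := by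
  simp only [sum_sq_sub_sum_delay_sq]
  rw [integral_finsetSum _ fun t _ => hμ.integrable_sq t]
  calc _ ≤ ∑ t with n ≤ (t : Fin n).1 + i, Q := Finset.sum_le_sum fun t _ => hμ.integral_sq_le t
    _ = (Finset.univ.filter fun t : Fin n => n ≤ t.1 + i).card * Q := by simp
    _ ≤ i * Q := by
      gcongr
      have : (Finset.univ.filter fun t : Fin n => n ≤ t.1 + i).card ≤ (Finset.range i).card := by
        refine Finset.card_le_card_of_injOn (fun t => n - 1 - t.1) ?_ ?_
        · intro t ht
          simp at ht ⊢
          omega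
        · intro t _ s _ hts
          ext
          simp at hts
          omega
      simpa using this

end IsSymmetricEnsemble

/-! ### Concentration of the empirical correlations and powers. -/

section Concentration

theorem measure_le_ofReal_of_integral_le {α : Type*} [MeasurableSpace α] {μ : Measure α}
    [IsFiniteMeasure μ] {f : α → ℝ} (hf0 : ∀ x, 0 ≤ f x) (hf : Integrable f μ) {c I : ℝ}
    (hc : 0 < c) (hI : ∫ x, f x ∂μ ≤ I) : μ {x | c ≤ f x} ≤ ENNReal.ofReal (I / c) := by
  have h := mul_meas_ge_le_integral_of_nonneg (Eventually.of_forall hf0) hf c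
  rw [← ofReal_measureReal]
  refine ENNReal.ofReal_le_ofReal ?_
  rw [le_div_iff₀' hc]
  exact h.trans hI

variable {μ : ∀ n, Measure (Fin n → ℝ)} {Q σ : ℝ}

theorem TendstoInProb.comp_fst {f : ∀ n, (Fin n → ℝ) → ℝ} {a : ℝ} (hf : TendstoInProb μ f a) :
    TendstoInProb (fun n => (μ n).prod (noise n σ)) (fun n p => f n p.1) a := fun η hη =>
  tendsto_zero_of_eventually_le (hf η hη) (Eventually.of_forall fun n =>
    measurePreserving_fst.measure_preimage_le {x | η ≤ |f n x - a|})

theorem tendstoInProb_autocorrelation_of_lt (hQ : 0 ≤ Q)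
    (hμ : ∀ᶠ n in atTop, IsSymmetricEnsemble (μ n) Q) {i j : ℕ} (hij : i < j) :
    TendstoInProb μ (fun n x => (n : ℝ)⁻¹ * ∑ t, delay i x t * delay j x t) 0 := by
  refine TendstoInProb.of_le (fun η n => 2 * Q ^ 2 / η ^ 2 / n)
    (fun η _ => tendsto_const_div_atTop_nhds_zero_nat _) fun η hη => ?_
  filter_upwards [hμ, eventually_ge_atTop 2] with n hn hn2
  have := hn.isProbabilityMeasure
  have hn2' : (2 : ℝ) ≤ n := by exact_mod_cast hn2
  have hn0 : (0 : ℝ) < n := by linarith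
  have hint : Integrable (fun x : Fin n → ℝ => (∑ t, delay i x t * delay j x t) ^ 2) (μ n) := by
    simp only [sq (∑ t, _), Finset.sum_mul_sum]
    exact integrable_finsetSum _ fun t _ => integrable_finsetSum _ fun s _ =>
      hn.integrable_delay_mul i j i j t t s s
  -- The factor 2 bounds n/(n - 1) for n ≥ 2.
  have hI : ∫ x : Fin n → ℝ, (∑ t, delay i x t * delay j x t) ^ 2 ∂μ n ≤ 2 * n * Q ^ 2 := by
    refine (hn.integral_sq_autocorrelation_le hQ hn2 hij).trans ?_
    rw [mul_div_assoc', div_le_iff₀ (by linarith)]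
    nlinarith [mul_nonneg (mul_nonneg hn0.le (sq_nonneg Q)) (sub_nonneg.2 hn2')]
  have h := measure_le_ofReal_of_integral_le (fun _ => sq_nonneg _) hint
    (c := (n * η) ^ 2) (by positivity) hI
  rw [show 2 * n * Q ^ 2 / (n * η) ^ 2 = 2 * Q ^ 2 / η ^ 2 / n by field_simp] at h
  refine (measure_mono fun x hx => ?_).trans h
  simp only [Set.mem_ofPred_eq, sub_zero, abs_mul, abs_inv, Nat.abs_cast] at hx ⊢
  rw [← sq_abs (∑ t, _)]
  rw [inv_mul_eq_div, le_div_iff₀' hn0] at hx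
  gcongr

theorem tendstoInProb_delay_energy (hQ : 0 ≤ Q)
    (hμ : ∀ᶠ n in atTop, IsSymmetricEnsemble (μ n) Q)
    (hpow : TendstoInProb μ (fun n x => (n : ℝ)⁻¹ * ∑ t, x t ^ 2) Q) (i : ℕ) :
    TendstoInProb μ (fun n x => (n : ℝ)⁻¹ * ∑ t, delay i x t * delay i x t) Q := by
  have hloss : TendstoInProb μ
      (fun n x => (n : ℝ)⁻¹ * (∑ t, x t ^ 2 - ∑ t, delay i x t ^ 2)) 0 := by
    refine TendstoInProb.of_le (fun η n => i * Q / η / n)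
      (fun η _ => tendsto_const_div_atTop_nhds_zero_nat _) fun η hη => ?_
    filter_upwards [hμ, eventually_ge_atTop 1] with n hn hn1
    have := hn.isProbabilityMeasure
    have hn0 : (0 : ℝ) < n := by exact_mod_cast hn1
    have hint : Integrable (fun x : Fin n → ℝ => ∑ t, x t ^ 2 - ∑ t, delay i x t ^ 2) (μ n) := by
      simp only [sum_sq_sub_sum_delay_sq]
      exact integrable_finsetSum _ fun t _ => hn.integrable_sq t
    have h := measure_le_ofReal_of_integral_le
      (fun x => sub_nonneg.2 (sum_delay_sq_le i x)) hint
      (c := n * η) (by positivity) (hn.integral_sum_sq_sub_delay_le hQ i)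
    rw [show i * Q / (n * η) = i * Q / η / n by field_simp] at h
    refine (measure_mono fun x hx => ?_).trans h
    simp only [Set.mem_ofPred_eq, sub_zero, abs_mul, abs_inv, Nat.abs_cast] at hx ⊢
    rw [abs_of_nonneg (sub_nonneg.2 (sum_delay_sq_le i x))] at hx
    rwa [inv_mul_eq_div, le_div_iff₀' hn0] at hx
  have h := hpow.add (hloss.const_mul (-1))
  rw [mul_zero, add_zero] at h
  refine h.congr (Eventually.of_forall fun n x => ?_)
  simp only [sq]
  ring

theorem tendstoInProb_autocorrelation (hQ : 0 ≤ Q)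
    (hμ : ∀ᶠ n in atTop, IsSymmetricEnsemble (μ n) Q)
    (hpow : TendstoInProb μ (fun n x => (n : ℝ)⁻¹ * ∑ t, x t ^ 2) Q) (i j : ℕ) :
    TendstoInProb μ (fun n x => (n : ℝ)⁻¹ * ∑ t, delay i x t * delay j x t)
      (if i = j then Q else 0) := by
  rcases lt_trichotomy i j with hij | rfl | hij
  · rw [if_neg hij.ne]
    exact tendstoInProb_autocorrelation_of_lt hQ hμ hij
  · rw [if_pos rfl]
    exact tendstoInProb_delay_energy hQ hμ hpow i
  · rw [if_neg hij.ne']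
    simpa only [mul_comm (delay i _ _)] using tendstoInProb_autocorrelation_of_lt hQ hμ hij

/-- Given the input, the sum is centred with variance at most σ²nQ. Chebyshev applies to each fixed
input, and the bound is then integrated over the inputs. -/
theorem tendstoInProb_delay_noise (hμ : ∀ᶠ n in atTop, IsSymmetricEnsemble (μ n) Q) (i : ℕ) :
    TendstoInProb (fun n => (μ n).prod (noise n σ))
      (fun n p => (n : ℝ)⁻¹ * ∑ t, delay i p.1 t * p.2 t) 0 := by
  refine TendstoInProb.of_le (fun η n => σ ^ 2 * Q / η ^ 2 / n)
    (fun η _ => tendsto_const_div_atTop_nhds_zero_nat _) fun η hη => ?_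
  filter_upwards [hμ, eventually_ge_atTop 1] with n hn hn1
  have := hn.isProbabilityMeasure
  have hn0 : (0 : ℝ) < n := by exact_mod_cast hn1
  have hm : Measurable fun p : (Fin n → ℝ) × (Fin n → ℝ) => ∑ t, delay i p.1 t * p.2 t :=
    Finset.measurable_sum _ fun t _ => by
      exact ((measurable_delay i t).comp measurable_fst).mul (by fun_prop)
  rw [Measure.prod_apply (measurableSet_le measurable_const
    ((hm.const_mul _).sub_const _).abs)]
  calc _ ≤ ∫⁻ _, ENNReal.ofReal (σ ^ 2 * Q / η ^ 2 / n) ∂μ n := by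
        refine lintegral_mono_ae ?_
        filter_upwards [hn.power_le] with x hx
        refine le_trans (measure_mono fun w hw => ?_)
          ((noise_inner_deviation_le σ (delay i x) (c := n * η) (by positivity)).trans
          (ENNReal.ofReal_le_ofReal ?_))
        · simp only [Set.mem_preimage, Set.mem_ofPred_eq, sub_zero, abs_mul, abs_inv,
            Nat.abs_cast] at hw ⊢
          rwa [inv_mul_eq_div, le_div_iff₀' hn0] at hw
        · calc _ ≤ σ ^ 2 * (n * Q) / (n * η) ^ 2 := by
                gcongr
                exact (sum_delay_sq_le i x).trans hx
            _ = _ := by field_simp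
    _ = _ := by simp

theorem tendstoInProb_noise_energy (hμ : ∀ᶠ n in atTop, IsSymmetricEnsemble (μ n) Q) :
    TendstoInProb (fun n => (μ n).prod (noise n σ))
      (fun n p => (n : ℝ)⁻¹ * ∑ t, p.2 t ^ 2) (σ ^ 2) := by
  set V := Var[fun x => x ^ 2; gaussianReal 0 (σ ^ 2).toNNReal]
  refine TendstoInProb.of_le (fun η n => V / η ^ 2 / n)
    (fun η _ => tendsto_const_div_atTop_nhds_zero_nat _) fun η hη => ?_
  filter_upwards [hμ, eventually_ge_atTop 1] with n hn hn1
  have := hn.isProbabilityMeasure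
  have hn0 : (0 : ℝ) < n := by exact_mod_cast hn1
  refine (measurePreserving_snd.measure_preimage_le
    {w : Fin n → ℝ | η ≤ |(n : ℝ)⁻¹ * ∑ t, w t ^ 2 - σ ^ 2|}).trans ?_
  have h := noise_sq_deviation_le (n := n) σ (c := n * η) (by positivity)
  rw [show n * V / (n * η) ^ 2 = V / η ^ 2 / n by field_simp] at h
  refine (measure_mono fun w hw => ?_).trans h
  simp only [Set.mem_ofPred_eq] at hw ⊢
  have : ∑ t, w t ^ 2 - n * σ ^ 2 = n * ((n : ℝ)⁻¹ * ∑ t, w t ^ 2 - σ ^ 2) := by field_simp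
  rw [this, abs_mul, Nat.abs_cast]
  gcongr

/-- The empirical correlation of the input and the output of the channel concentrates. -/
theorem tendstoInProb_correlation {K : ℕ} (h : Fin (K + 1) → ℝ) (hQ : 0 ≤ Q)
    (hμ : ∀ᶠ n in atTop, IsSymmetricEnsemble (μ n) Q)
    (hpow : TendstoInProb μ (fun n x => (n : ℝ)⁻¹ * ∑ t, x t ^ 2) Q) :
    TendstoInProb (fun n => (μ n).prod (noise n σ))
      (fun n p => (n : ℝ)⁻¹ * ∑ t, p.1 t * (filterOutput h p.1 t + p.2 t)) (h 0 * Q) := by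
  have h1 := TendstoInProb.sum Finset.univ fun (i : Fin (K + 1)) _ =>
    ((tendstoInProb_autocorrelation hQ hμ hpow 0 i).comp_fst (σ := σ)).const_mul (h i)
  have h2 := h1.add (tendstoInProb_delay_noise (σ := σ) hμ 0)
  have hlim : ∑ i : Fin (K + 1), h i * (if 0 = (i : ℕ) then Q else 0) + 0 = h 0 * Q := by
    rw [add_zero, Finset.sum_eq_single 0]
    · simp
    · intro b _ hb
      rw [if_neg fun h0 => hb (Fin.ext h0.symm), mul_zero]
    · simp
  rw [hlim] at h2
  refine h2.congr (Eventually.of_forall fun n p => ?_)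
  simp only [delay_zero, filterOutput_eq, mul_add, Finset.sum_add_distrib, Finset.mul_sum]
  rw [Finset.sum_comm]
  congr 1
  refine Finset.sum_congr rfl fun t _ => Finset.sum_congr rfl fun i _ => ?_
  ring

/-- The empirical power of the output of the channel concentrates. -/
theorem tendstoInProb_output_energy {K : ℕ} (h : Fin (K + 1) → ℝ) (hQ : 0 ≤ Q)
    (hμ : ∀ᶠ n in atTop, IsSymmetricEnsemble (μ n) Q)
    (hpow : TendstoInProb μ (fun n x => (n : ℝ)⁻¹ * ∑ t, x t ^ 2) Q) :
    TendstoInProb (fun n => (μ n).prod (noise n σ))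
      (fun n p => (n : ℝ)⁻¹ * ∑ t, (filterOutput h p.1 t + p.2 t) ^ 2)
      ((∑ i, h i ^ 2) * Q + σ ^ 2) := by
  have h1 := TendstoInProb.sum Finset.univ fun (i : Fin (K + 1)) _ =>
    (TendstoInProb.sum Finset.univ fun (j : Fin (K + 1)) _ =>
      ((tendstoInProb_autocorrelation hQ hμ hpow i j).comp_fst (σ := σ)).const_mul
        (h j)).const_mul (h i)
  have h2 := TendstoInProb.sum Finset.univ fun (i : Fin (K + 1)) _ =>
    (tendstoInProb_delay_noise (σ := σ) hμ i).const_mul (2 * h i)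
  have h3 := (h1.add h2).add (tendstoInProb_noise_energy hμ)
  have hlim : ∑ i : Fin (K + 1), h i * ∑ j : Fin (K + 1), h j *
      (if (i : ℕ) = (j : ℕ) then Q else 0) + ∑ i : Fin (K + 1), 2 * h i * 0 + σ ^ 2 =
      (∑ i, h i ^ 2) * Q + σ ^ 2 := by
    simp only [mul_zero, Finset.sum_const_zero, add_zero, Fin.val_inj, mul_ite,
      Finset.sum_ite_eq, Finset.mem_univ, if_true, Finset.sum_mul]
    congr 1
    exact Finset.sum_congr rfl fun i _ => by ring
  rw [hlim] at h3
  refine h3.congr (Eventually.of_forall fun n p => ?_)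
  have hexp : ∀ t, (filterOutput h p.1 t + p.2 t) ^ 2 =
      ∑ i : Fin (K + 1), ∑ j : Fin (K + 1), h i * h j * (delay i p.1 t * delay j p.1 t) +
      ∑ i : Fin (K + 1), 2 * h i * (delay i p.1 t * p.2 t) + p.2 t ^ 2 := fun t => by
    rw [filterOutput_eq, add_sq, sq (∑ i, _), Finset.sum_mul_sum, mul_assoc, Finset.sum_mul,
      Finset.mul_sum]
    congr 2
    · exact Finset.sum_congr rfl fun i _ => Finset.sum_congr rfl fun j _ => by ring
    · exact Finset.sum_congr rfl fun i _ => by ring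
  simp only [hexp, Finset.sum_add_distrib, mul_add]
  congr 2
  · rw [Finset.sum_comm, Finset.mul_sum]
    refine Finset.sum_congr rfl fun i _ => ?_
    rw [Finset.sum_comm, Finset.mul_sum, Finset.mul_sum]
    refine Finset.sum_congr rfl fun j _ => ?_
    rw [← Finset.mul_sum]
    ring
  · rw [Finset.sum_comm, Finset.mul_sum]
    refine Finset.sum_congr rfl fun i _ => ?_
    rw [← Finset.mul_sum]
    ring

end Concentration

/-! ### Volumes of Euclidean balls and caps. -/

section Volume

open scoped Pointwise

/-- The open Euclidean ball of squared radius `s` in `Fin n → ℝ`. -/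
def sqBall (n : ℕ) (s : ℝ) : Set (Fin n → ℝ) :=
  {x | ∑ t, x t ^ 2 < s}

variable {n : ℕ}

theorem isOpen_sqBall (s : ℝ) : IsOpen (sqBall n s) :=
  isOpen_lt (by fun_prop) continuous_const

theorem measurableSet_sqBall (s : ℝ) : MeasurableSet (sqBall n s) :=
  (isOpen_sqBall s).measurableSet

theorem sqBall_eq_empty {s : ℝ} (hs : s ≤ 0) : sqBall n s = ∅ := by
  ext x
  simp only [sqBall, Set.mem_ofPred_eq, Set.mem_empty_iff_false, iff_false, not_lt]
  exact hs.trans (Finset.sum_nonneg fun _ _ => sq_nonneg _)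

/-- Homogeneity of Lebesgue measure. For `r ≤ 0` the ball is empty and `√r = 0`, so the formula
persists when `n ≠ 0`; thus factors such as 1 - c² need no sign condition. -/
theorem volume_sqBall_mul (hn : n ≠ 0) (r s : ℝ) (hs : 0 ≤ s) :
    volume (sqBall n (r * s)) = ENNReal.ofReal (√r ^ n) * volume (sqBall n s) := by
  rcases le_or_gt r 0 with hr | hr
  · rw [sqBall_eq_empty (mul_nonpos_of_nonpos_of_nonneg hr hs), Real.sqrt_eq_zero_of_nonpos hr]
    simp [hn]
  · have hr' : √r ≠ 0 := (Real.sqrt_pos.2 hr).ne'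
    have h : sqBall n (r * s) = √r • sqBall n s := by
      ext x
      rw [Set.mem_smul_set_iff_inv_smul_mem₀ hr']
      simp only [sqBall, Set.mem_ofPred_eq, Pi.smul_apply, smul_eq_mul, mul_pow, inv_pow,
        Real.sq_sqrt hr.le, ← Finset.mul_sum]
      rw [inv_mul_lt_iff₀ hr]
    rw [h, Measure.addHaar_smul, Module.finrank_fin_fun, abs_of_nonneg (by positivity)]

theorem volume_sqBall_pos {s : ℝ} (hs : 0 < s) : 0 < volume (sqBall n s) :=
  (isOpen_sqBall s).measure_pos _ ⟨0, by simpa [sqBall] using hs⟩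

theorem volume_sqBall_ne_top (s : ℝ) : volume (sqBall n s) ≠ ∞ := by
  refine ((measure_mono fun x hx => ?_).trans_lt
    (isCompact_closedBall (0 : Fin n → ℝ) (√s)).measure_lt_top).ne
  rw [mem_closedBall_zero_iff, pi_norm_le_iff_of_nonneg (Real.sqrt_nonneg _)]
  refine fun t => Real.abs_le_sqrt (le_trans ?_ (le_of_lt hx))
  exact Finset.single_le_sum (f := fun t => x t ^ 2) (fun _ _ => sq_nonneg _) (Finset.mem_univ _)

theorem volume_sqBall_translate (a : Fin n → ℝ) (s : ℝ) :
    volume {x : Fin n → ℝ | ∑ t, (x t - a t) ^ 2 < s} = volume (sqBall n s) :=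
  (measurePreserving_sub_right volume a).measure_preimage
    (measurableSet_sqBall s).nullMeasurableSet

theorem sum_sq_pos {v : Fin n → ℝ} (hv : v ≠ 0) : 0 < ∑ t, v t ^ 2 := by
  obtain ⟨t, ht⟩ := Function.ne_iff.1 hv
  exact Finset.sum_pos' (fun _ _ => sq_nonneg _) ⟨t, Finset.mem_univ _, by
    have : v t ≠ 0 := ht
    positivity⟩

/-- A cap of the ball is contained in the translated ball spanned by its rim. -/
theorem cap_subset {c s : ℝ} (hc : 0 ≤ c) (hs : 0 < s) {v : Fin n → ℝ} (hv : v ≠ 0)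
    {x : Fin n → ℝ} (hx : x ∈ sqBall n s) (hxv : c * √s * √(∑ t, v t ^ 2) ≤ ∑ t, x t * v t) :
    ∑ t, (x t - c * √s / √(∑ t, v t ^ 2) * v t) ^ 2 < (1 - c ^ 2) * s := by
  have hx' : ∑ t, x t ^ 2 < s := hx
  have hV := sum_sq_pos hv
  set V := ∑ t, v t ^ 2 with hVdef
  have hsV : 0 < √V := Real.sqrt_pos.2 hV
  set k := c * √s / √V with hk
  have hk0 : 0 ≤ k := by positivity
  have hexp : ∑ t, (x t - k * v t) ^ 2 = ∑ t, x t ^ 2 - 2 * k * ∑ t, x t * v t + k ^ 2 * V := by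
    rw [hVdef, Finset.mul_sum, Finset.mul_sum, ← Finset.sum_sub_distrib, ← Finset.sum_add_distrib]
    exact Finset.sum_congr rfl fun t _ => by ring
  have h1 : k ^ 2 * V = c ^ 2 * s := by
    rw [hk, div_pow, mul_pow, Real.sq_sqrt hs.le, Real.sq_sqrt hV.le]
    field_simp
  have h2 : k * (c * √s * √V) = c ^ 2 * s := by
    rw [hk]
    field_simp
    rw [Real.sq_sqrt hs.le]
  rw [hexp, h1]
  -- Here k⟨x, v⟩ ≥ c²s, so the expansion is below s - 2c²s + c²s.
  nlinarith [mul_le_mul_of_nonneg_left hxv hk0]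

/-- The absolute value gives two caps, around `v` and `-v`; each lies in a translate of the smaller
ball, whence the factor 2. -/
theorem volume_cap_le (hn : n ≠ 0) {c s : ℝ} (hc : 0 ≤ c) (hs : 0 < s) {v : Fin n → ℝ}
    (hv : v ≠ 0) :
    volume (sqBall n s ∩ {x | c * √s * √(∑ t, v t ^ 2) ≤ |∑ t, x t * v t|}) ≤
      2 * ENNReal.ofReal (√(1 - c ^ 2) ^ n) * volume (sqBall n s) := by
  set k := c * √s / √(∑ t, v t ^ 2) with hk
  have hsub : sqBall n s ∩ {x | c * √s * √(∑ t, v t ^ 2) ≤ |∑ t, x t * v t|} ⊆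
      {x | ∑ t, (x t - (k • v) t) ^ 2 < (1 - c ^ 2) * s} ∪
      {x | ∑ t, (x t - (k • -v) t) ^ 2 < (1 - c ^ 2) * s} := by
    rintro x ⟨hx, hxv⟩
    rw [Set.mem_ofPred_eq] at hxv
    rcases le_abs.1 hxv with h | h
    · left
      simpa [← hk] using cap_subset hc hs hv hx h
    · right
      have := cap_subset hc hs (neg_ne_zero.2 hv) hx
        (by simpa [Finset.sum_neg_distrib] using h)
      simpa [← hk] using this
  refine (measure_mono hsub).trans ((measure_union_le _ _).trans ?_)
  rw [volume_sqBall_translate, volume_sqBall_translate, volume_sqBall_mul hn _ _ hs.le, ← two_mul,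
    mul_assoc]

end Volume

/-! ### Permutations and sign changes as volume preserving isometries. -/

section Invariance

variable {n : ℕ}

/-- A volume preserving linear isometry of the Euclidean structure of `Fin n → ℝ`. -/
structure IsVolumeIsometry (g : (Fin n → ℝ) → Fin n → ℝ) : Prop where
  measurePreserving : MeasurePreserving g volume volume
  sum_sq : ∀ x, ∑ t, g x t ^ 2 = ∑ t, x t ^ 2
  map_smul : ∀ (c : ℝ) (x : Fin n → ℝ), g (c • x) = c • g x

theorem isVolumeIsometry_perm (e : Equiv.Perm (Fin n)) :
    IsVolumeIsometry fun (x : Fin n → ℝ) t => x (e t) where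
  measurePreserving := by
    have h := volume_measurePreserving_piCongrLeft (fun _ : Fin n => ℝ) e.symm
    convert! h using 1
    ext x t
    have := Equiv.piCongrLeft_apply_apply (fun _ : Fin n => ℝ) e.symm x (e t)
    rw [Equiv.symm_apply_apply] at this
    exact this.symm
  sum_sq x := Equiv.sum_comp e fun t => x t ^ 2
  map_smul c x := rfl

theorem isVolumeIsometry_flip (a : Fin n) :
    IsVolumeIsometry fun x : Fin n → ℝ => Function.update x a (-x a) where
  measurePreserving := by
    have h := volume_preserving_pi (α' := fun _ : Fin n => ℝ) (β' := fun _ : Fin n => ℝ)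
      (f := fun t x => if t = a then -x else x) fun t => by
        split_ifs
        · exact Measure.measurePreserving_neg volume
        · exact MeasurePreserving.id volume
    convert! h using 1
    ext x t
    by_cases ht : t = a
    · subst ht; simp
    · simp [ht]
  sum_sq x := by
    refine Finset.sum_congr rfl fun t _ => ?_
    by_cases ht : t = a
    · subst ht; simp
    · simp [ht]
  map_smul c x := by
    ext t
    by_cases ht : t = a
    · subst ht; simp
    · simp [ht]

theorem measurePreserving_cond {α : Type*} [MeasurableSpace α] {μ : Measure α}
    {g : α → α} (hg : MeasurePreserving g μ μ) {S : Set α} (hS : MeasurableSet S)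
    (hgS : g ⁻¹' S = S) :
    MeasurePreserving g (ProbabilityTheory.cond μ S) (ProbabilityTheory.cond μ S) := by
  have h := hg.restrict_preimage hS
  rw [hgS] at h
  exact h.smul_measure _

end Invariance

/-- Random codewords of growing length with a symmetric law, whose empirical power is at most `Q`
and tends to `Q` in probability, and for which the probability of a pair of opposite caps decays at
the exponential rate of the uniform distribution on the sphere. -/
structure IsCodingEnsemble (μ : ∀ n, Measure (Fin n → ℝ)) (Q : ℝ) : Prop where
  isSymmetricEnsemble : ∀ᶠ n in atTop, IsSymmetricEnsemble (μ n) Q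
  tendsto_power : TendstoInProb μ (fun n x => (n : ℝ)⁻¹ * ∑ t, x t ^ 2) Q
  cap_le : ∀ c' c : ℝ, 0 < c' → c' < c → ∀ᶠ n : ℕ in atTop, ∀ v : Fin n → ℝ, v ≠ 0 →
    μ n {x | c * √(n * Q) * √(∑ t, v t ^ 2) ≤ |∑ t, x t * v t|} ≤
      4 * ENNReal.ofReal (√(1 - c' ^ 2) ^ n)

/-- Absorption: when a set is covered by a part carrying at most half its volume and a remainder,
the remainder controls it up to a factor 2. Finiteness of `a` is what permits the subtraction. -/
theorem le_two_mul_of_le_half_add {a b : ℝ≥0∞} (ha : a ≠ ∞) {k : ℝ} (hk0 : 0 ≤ k)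
    (hk : k ≤ 1 / 2) (h : a ≤ ENNReal.ofReal k * a + b) : a ≤ 2 * b := by
  rcases eq_or_ne b ∞ with rfl | hb
  · simp
  lift a to ℝ≥0 using ha
  lift b to ℝ≥0 using hb
  have h' : (a : ℝ) ≤ k * a + b := by
    have := ENNReal.toReal_mono (by finiteness) h
    rw [ENNReal.toReal_add (by finiteness) (by finiteness)] at this
    simpa [hk0] using this
  have h'' : (a : ℝ) ≤ 2 * b := by nlinarith [a.coe_nonneg]
  exact_mod_cast h''

theorem eventually_pow_le_half {k : ℝ} (hk0 : 0 ≤ k) (hk : k < 1) :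
    ∀ᶠ n : ℕ in atTop, k ^ n ≤ 1 / 2 :=
  (tendsto_pow_atTop_nhds_zero_of_lt_one hk0 hk).eventually_le_const (by norm_num)

/-! ### The power shell. -/

section Shell

variable {n : ℕ} {P ε : ℝ}

theorem mem_powerShell_iff (hn : n ≠ 0) {x : Fin n → ℝ} :
    x ∈ powerShell n P ε ↔ n * (P - ε) < ∑ t, x t ^ 2 ∧ ∑ t, x t ^ 2 < n * (P + ε) := by
  have hn0 : (0 : ℝ) < n := by positivity
  rw [powerShell, Set.mem_ofPred_eq, abs_lt, one_div, inv_mul_eq_div, neg_lt_sub_iff_lt_add,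
    sub_lt_iff_lt_add', lt_div_iff₀' hn0 |>.symm, div_lt_iff₀' hn0 |>.symm]
  constructor
  · rintro ⟨h1, h2⟩
    exact ⟨by linarith, h2⟩
  · rintro ⟨h1, h2⟩
    exact ⟨by linarith, h2⟩

theorem measurableSet_powerShell : MeasurableSet (powerShell n P ε) :=
  measurableSet_lt (by fun_prop) measurable_const

theorem powerShell_subset_sqBall (hn : n ≠ 0) :
    powerShell n P ε ⊆ sqBall n (n * (P + ε)) := fun _ hx =>
  ((mem_powerShell_iff hn).1 hx).2

/-- The outer ball minus the ball of squared radius nP lies in the shell, and that inner ball has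
the exponentially small volume fraction (P/(P + ε))^(n/2). -/
theorem eventually_volume_sqBall_le_shell (hP : 0 < P) (hε : 0 < ε) :
    ∀ᶠ n : ℕ in atTop, volume (sqBall n (n * (P + ε))) ≤ 2 * volume (powerShell n P ε) := by
  have hk : √(P / (P + ε)) < 1 := by
    rw [Real.sqrt_lt' one_pos, one_pow, div_lt_one (by positivity)]
    linarith
  filter_upwards [eventually_pow_le_half (Real.sqrt_nonneg _) hk, eventually_ge_atTop 1]
    with n hn hn1
  have hn0 : n ≠ 0 := by omega
  refine le_two_mul_of_le_half_add (volume_sqBall_ne_top _) (by positivity) hn ?_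
  rw [← volume_sqBall_mul hn0 _ _ (by positivity),
    show P / (P + ε) * (n * (P + ε)) = n * P by field_simp]
  refine (measure_mono fun x hx => ?_).trans (measure_union_le _ _)
  by_cases hxP : ∑ t, x t ^ 2 < n * P
  · exact Or.inl hxP
  · refine Or.inr ((mem_powerShell_iff hn0).2 ⟨?_, hx⟩)
    have : (0 : ℝ) < n := by positivity
    nlinarith

/-- Turns volume estimates relative to the outer ball into probabilities under the shell law, at the
cost of a factor 2. -/
theorem uniformShell_le {A D : Set (Fin n → ℝ)} {k : ℝ≥0∞} (hP : 0 < P) (hε : 0 < ε) (hn : n ≠ 0)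
    (hvol : volume (sqBall n (n * (P + ε))) ≤ 2 * volume (powerShell n P ε))
    (hAD : powerShell n P ε ∩ A ⊆ D) (hD : volume D ≤ k * volume (sqBall n (n * (P + ε)))) :
    uniformShell n P ε A ≤ 2 * k := by
  rw [uniformShell, cond_apply measurableSet_powerShell]
  have h0 : volume (powerShell n P ε) ≠ 0 := fun h => by
    rw [h, mul_zero] at hvol
    exact (volume_sqBall_pos (n := n) (s := n * (P + ε)) (by positivity)).not_ge hvol
  have htop : volume (powerShell n P ε) ≠ ∞ :=
    measure_ne_top_of_subset (powerShell_subset_sqBall hn) (volume_sqBall_ne_top _)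
  rw [ENNReal.inv_mul_le_iff h0 htop]
  calc volume (powerShell n P ε ∩ A) ≤ k * volume (sqBall n (n * (P + ε))) :=
        (measure_mono hAD).trans hD
    _ ≤ k * (2 * volume (powerShell n P ε)) := by gcongr
    _ = volume (powerShell n P ε) * (2 * k) := by ring

theorem isSymmetricEnsemble_uniformShell (hP : 0 < P) (hε : 0 < ε) (hn : n ≠ 0)
    (hvol : volume (sqBall n (n * (P + ε))) ≤ 2 * volume (powerShell n P ε)) :
    IsSymmetricEnsemble (uniformShell n P ε) (P + ε) := by
  have hinv : ∀ g : (Fin n → ℝ) → Fin n → ℝ, IsVolumeIsometry g →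
      MeasurePreserving g (uniformShell n P ε) (uniformShell n P ε) := fun g hg =>
    measurePreserving_cond hg.measurePreserving measurableSet_powerShell (by
      ext x
      simp only [Set.mem_preimage, powerShell, Set.mem_ofPred_eq, hg.sum_sq])
  refine ⟨?_, fun e => hinv _ (isVolumeIsometry_perm e), fun a => hinv _ (isVolumeIsometry_flip a),
    ?_⟩
  · refine cond_isProbabilityMeasure_of_finite (fun h => ?_)
      (measure_ne_top_of_subset (powerShell_subset_sqBall hn) (volume_sqBall_ne_top _))
    rw [h, mul_zero] at hvol
    exact (volume_sqBall_pos (n := n) (s := n * (P + ε)) (by positivity)).not_ge hvol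
  · filter_upwards [ae_cond_mem (μ := volume) (measurableSet_powerShell (n := n) (P := P) (ε := ε))]
      with x hx
    exact ((mem_powerShell_iff hn).1 hx).2.le

theorem isCodingEnsemble_uniformShell (hP : 0 < P) (hε : 0 < ε) :
    IsCodingEnsemble (fun n => uniformShell n P ε) (P + ε) where
  isSymmetricEnsemble := by
    filter_upwards [eventually_volume_sqBall_le_shell hP hε, eventually_ge_atTop 1] with n hn hn1
    exact isSymmetricEnsemble_uniformShell hP hε (by omega) hn
  tendsto_power := by
    -- A deviation by η puts the word in the closed ball of squared radius n(P + ε - η); halving η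
    -- makes room for an open ball.
    refine TendstoInProb.of_le (fun η n => 2 * √(1 - η / (2 * (P + ε))) ^ n) (fun η hη => ?_)
      fun η hη => ?_
    · have hk : √(1 - η / (2 * (P + ε))) < 1 := by
        rw [Real.sqrt_lt' one_pos, one_pow]
        have : 0 < η / (2 * (P + ε)) := by positivity
        linarith
      simpa using (tendsto_pow_atTop_nhds_zero_of_lt_one (Real.sqrt_nonneg _) hk).const_mul 2
    · filter_upwards [eventually_volume_sqBall_le_shell hP hε, eventually_ge_atTop 1] with n hn hn1
      have hn0 : n ≠ 0 := by omega
      have hnpos : (0 : ℝ) < n := by positivity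
      rw [ENNReal.ofReal_mul (by norm_num), ENNReal.ofReal_ofNat]
      refine uniformShell_le hP hε hn0 hn
        (D := sqBall n ((1 - η / (2 * (P + ε))) * (n * (P + ε)))) ?_
        (volume_sqBall_mul hn0 _ _ (by positivity)).le
      rintro x ⟨hx, hxη⟩
      have hx2 := ((mem_powerShell_iff hn0).1 hx).2
      rw [Set.mem_ofPred_eq, inv_mul_eq_div, abs_of_nonpos (by
        rw [sub_nonpos, div_le_iff₀' hnpos]; exact hx2.le)] at hxη
      have h1 : (∑ t, x t ^ 2) / n ≤ P + ε - η := by linarith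
      rw [div_le_iff₀' hnpos] at h1
      have h2 : (1 - η / (2 * (P + ε))) * (n * (P + ε)) = n * (P + ε - η / 2) := by field_simp
      rw [sqBall, Set.mem_ofPred_eq, h2]
      nlinarith
  cap_le := by
    intro c' c hc' hc
    filter_upwards [eventually_volume_sqBall_le_shell hP hε, eventually_ge_atTop 1] with n hn hn1 v hv
    have hn0 : n ≠ 0 := by omega
    -- One factor 2 compares the shell with the ball, the other counts the two caps.
    rw [show (4 : ℝ≥0∞) = 2 * 2 by norm_num, mul_assoc (2 : ℝ≥0∞)]
    refine uniformShell_le hP hε hn0 hn (Set.inter_subset_inter_left _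
      (powerShell_subset_sqBall hn0)) ?_
    refine (volume_cap_le hn0 (hc'.trans hc).le (by positivity) hv).trans ?_
    gcongr

end Shell

/-! ### The sphere, seen as the radial projection of the ball. -/

section Sphere

open scoped Pointwise

variable {n : ℕ} {P : ℝ}

/-- Radial projection to the sphere of squared radius `s`. -/
noncomputable def radialProj (s : ℝ) (x : Fin n → ℝ) : Fin n → ℝ :=
  (√s / √(∑ t, x t ^ 2)) • x

@[fun_prop]
theorem measurable_radialProj (s : ℝ) : Measurable (radialProj s : (Fin n → ℝ) → Fin n → ℝ) := by
  unfold radialProj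
  fun_prop

theorem sum_sq_radialProj {s : ℝ} (hs : 0 ≤ s) {x : Fin n → ℝ} (hx : x ≠ 0) :
    ∑ t, radialProj s x t ^ 2 = s := by
  have := sum_sq_pos hx
  simp only [radialProj, Pi.smul_apply, smul_eq_mul, mul_pow, div_pow, ← Finset.mul_sum,
    Real.sq_sqrt hs, Real.sq_sqrt this.le]
  field_simp

/-- `toSphere` assigns to a set `n` times the volume of the cone over it in the unit ball. That cone
consists of the nonzero points projecting radially into the set; the origin is null and the factor
`n` cancels on normalizing. -/
theorem uniformSphere_eq_map_radialProj (hn : n ≠ 0) (P : ℝ) :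
    uniformSphere n P =
      (ProbabilityTheory.cond volume (sqBall n 1)).map (radialProj (n * P)) := by
  have : NeZero n := ⟨hn⟩
  have hnorm : ∀ x : Fin n → ℝ, ‖WithLp.toLp 2 x‖ = √(∑ t, x t ^ 2) := fun x => by
    simp [EuclideanSpace.norm_eq]
  have hmeas : Measurable fun (u : Metric.sphere (0 : EuclideanSpace ℝ (Fin n)) 1) (t : Fin n) =>
      √(n * P) * u.1 t := by
    refine measurable_pi_lambda _ fun t => Measurable.const_mul ?_ _
    have : Continuous fun u : Metric.sphere (0 : EuclideanSpace ℝ (Fin n)) 1 => u.1 t := by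
      fun_prop
    exact this.measurable
  have hpre : ∀ S : Set (EuclideanSpace ℝ (Fin n)),
      volume S = volume (WithLp.toLp 2 ⁻¹' S : Set (Fin n → ℝ)) := fun S =>
    ((PiLp.volume_preserving_toLp (Fin n)).measure_preimage_emb
      (MeasurableEquiv.toLp 2 (Fin n → ℝ)).measurableEmbedding S).symm
  have hball : volume (Metric.ball (0 : EuclideanSpace ℝ (Fin n)) 1) = volume (sqBall n 1) := by
    rw [hpre]
    congr 1
    ext x
    simp only [Set.mem_preimage, mem_ball_zero_iff, hnorm, sqBall, Set.mem_ofPred_eq]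
    rw [Real.sqrt_lt' one_pos, one_pow]
  ext A hA
  rw [uniformSphere, Measure.map_apply hmeas hA,
    Measure.map_apply (measurable_radialProj _) hA, cond_apply MeasurableSet.univ,
    cond_apply (measurableSet_sqBall _), Set.univ_inter, Measure.toSphere_apply_univ,
    Measure.toSphere_apply' _ (hmeas hA), hball, finrank_euclideanSpace_fin]
  have hset : (WithLp.toLp 2 ⁻¹' (Set.Ioo (0 : ℝ) 1 • (Subtype.val '' ((fun
      (u : Metric.sphere (0 : EuclideanSpace ℝ (Fin n)) 1) (t : Fin n) => √(n * P) * u.1 t) ⁻¹' A)))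
      : Set (Fin n → ℝ)) = (sqBall n 1 ∩ radialProj (n * P) ⁻¹' A) \ {0} := by
    ext x
    simp only [Set.mem_preimage, Set.mem_smul, Set.mem_image, Set.mem_sdiff, Set.mem_inter_iff,
      Set.mem_singleton_iff, sqBall, Set.mem_ofPred_eq]
    constructor
    · rintro ⟨r, hr, _, ⟨u, hu, rfl⟩, hx⟩
      have hu1 : ‖u.1‖ = 1 := by simp
      have hxn : √(∑ t, x t ^ 2) = r := by
        rw [← hnorm, ← hx, norm_smul, hu1, mul_one, Real.norm_of_nonneg hr.1.le]
      have hxt : ∀ t, x t = r * u.1 t := fun t => by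
        have := congrArg (fun y : EuclideanSpace ℝ (Fin n) => y t) hx
        simpa using this.symm
      have hr0 := hr.1.ne'
      refine ⟨⟨?_, ?_⟩, ?_⟩
      · rw [← Real.sqrt_lt_sqrt_iff (Finset.sum_nonneg fun _ _ => sq_nonneg _), hxn, Real.sqrt_one]
        exact hr.2
      · convert! hu using 1
        ext t
        rw [radialProj, hxn, Pi.smul_apply, smul_eq_mul, hxt]
        field_simp
      · rintro rfl
        simp at hxn
        exact hr0 hxn.symm
    · rintro ⟨⟨hx1, hxA⟩, hx0⟩
      have hpos := Real.sqrt_pos.2 (sum_sq_pos hx0)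
      have hu : ‖(√(∑ t, x t ^ 2))⁻¹ • WithLp.toLp 2 x‖ = 1 := by
        rw [norm_smul, hnorm, Real.norm_of_nonneg (by positivity), inv_mul_cancel₀ hpos.ne']
      refine ⟨√(∑ t, x t ^ 2), ⟨hpos, ?_⟩, _, ⟨⟨(√(∑ t, x t ^ 2))⁻¹ • WithLp.toLp 2 x, by
        simpa using hu⟩, ?_, rfl⟩, ?_⟩
      · rwa [Real.sqrt_lt' one_pos, one_pow]
      · convert! hxA using 1
        ext t
        simp only [radialProj, Pi.smul_apply, PiLp.smul_apply, smul_eq_mul]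
        ring
      · rw [smul_smul, mul_inv_cancel₀ hpos.ne', one_smul]
  have : Nonempty (Fin n) := ⟨0⟩
  rw [hpre (Set.Ioo _ _ • _), hset, measure_sdiff_null (measure_singleton _),
    ENNReal.mul_inv (by simp [hn]) (by simp), mul_mul_mul_comm,
    ENNReal.inv_mul_cancel (by simp [hn]) (by simp), one_mul]

theorem ae_uniformSphere (hn : n ≠ 0) {p : (Fin n → ℝ) → Prop} (hp : MeasurableSet {x | p x})
    (h : ∀ x, x ≠ 0 → p (radialProj (n * P) x)) : ∀ᵐ x ∂uniformSphere n P, p x := by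
  have : Nonempty (Fin n) := ⟨⟨0, Nat.pos_of_ne_zero hn⟩⟩
  rw [uniformSphere_eq_map_radialProj hn, ae_map_iff (by fun_prop) hp]
  have h0 : ∀ᵐ x : Fin n → ℝ ∂volume, x ≠ 0 := by
    simp [ae_iff]
  filter_upwards [cond_absolutelyContinuous.ae_le h0] with x hx
  exact h x hx

theorem ae_uniformSphere_sum_sq (hn : n ≠ 0) (hP : 0 ≤ P) :
    ∀ᵐ x ∂uniformSphere n P, ∑ t, x t ^ 2 = n * P :=
  ae_uniformSphere hn (measurableSet_eq_fun (by fun_prop) measurable_const)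
    fun _ hx => sum_sq_radialProj (by positivity) hx

theorem isSymmetricEnsemble_uniformSphere (hn : n ≠ 0) (hP : 0 ≤ P) :
    IsSymmetricEnsemble (uniformSphere n P) P := by
  have hinv : ∀ g : (Fin n → ℝ) → Fin n → ℝ, IsVolumeIsometry g →
      MeasurePreserving g (uniformSphere n P) (uniformSphere n P) := fun g hg => by
    have hc := measurePreserving_cond hg.measurePreserving (measurableSet_sqBall (n := n) 1) (by
      ext x
      simp only [Set.mem_preimage, sqBall, Set.mem_ofPred_eq, hg.sum_sq])
    have hcomm : g ∘ radialProj (n * P) = radialProj (n * P) ∘ g := by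
      ext1 x
      simp only [Function.comp_apply, radialProj, hg.map_smul, hg.sum_sq]
    refine ⟨hg.measurePreserving.measurable, ?_⟩
    rw [uniformSphere_eq_map_radialProj hn,
      Measure.map_map hg.measurePreserving.measurable (by fun_prop), hcomm,
      ← Measure.map_map (by fun_prop) hg.measurePreserving.measurable, hc.map_eq]
  refine ⟨?_, fun e => hinv _ (isVolumeIsometry_perm e), fun a => hinv _ (isVolumeIsometry_flip a),
    (ae_uniformSphere_sum_sq hn hP).mono fun _ h => h.le⟩
  rw [uniformSphere_eq_map_radialProj hn]
  have := cond_isProbabilityMeasure_of_finite (volume_sqBall_pos (n := n) one_pos).ne'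
    (volume_sqBall_ne_top 1)
  exact Measure.isProbabilityMeasure_map (by fun_prop)

/-- By homogeneity, the volume of a cone in the ball is governed by its part near the boundary. -/
theorem volume_cone_le (hn : n ≠ 0) {c' c : ℝ} (hc' : 0 < c') (hc : c' < c)
    (hk : (c' / c) ^ n ≤ 1 / 2) {v : Fin n → ℝ} (hv : v ≠ 0) :
    volume (sqBall n 1 ∩ {x | c * √(∑ t, x t ^ 2) * √(∑ t, v t ^ 2) ≤ |∑ t, x t * v t|}) ≤
      4 * ENNReal.ofReal (√(1 - c' ^ 2) ^ n) * volume (sqBall n 1) := by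
  have hc0 : 0 < c := hc'.trans hc
  set k := c' / c with hkdef
  have hk0 : 0 < k := by positivity
  set D := sqBall n 1 ∩ {x | c * √(∑ t, x t ^ 2) * √(∑ t, v t ^ 2) ≤ |∑ t, x t * v t|} with hD
  -- The cone condition is scale invariant, so points of norm below k lie in k • D, of volume k^n
  -- times that of D. For the others c‖x‖ ≥ ck = c', which puts them in a cap.
  have hsub : D ⊆ k • D ∪
      (sqBall n 1 ∩ {x | c' * √1 * √(∑ t, v t ^ 2) ≤ |∑ t, x t * v t|}) := by
    rintro x ⟨hx1, hx2⟩
    rw [Set.mem_ofPred_eq] at hx2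
    rcases lt_or_ge √(∑ t, x t ^ 2) k with hxk | hxk
    · left
      rw [Set.mem_smul_set_iff_inv_smul_mem₀ hk0.ne']
      have hsum : ∑ t, (k⁻¹ • x) t ^ 2 = k⁻¹ ^ 2 * ∑ t, x t ^ 2 := by
        simp only [Pi.smul_apply, smul_eq_mul, mul_pow, Finset.mul_sum]
      refine ⟨?_, ?_⟩
      · rw [Real.sqrt_lt' hk0] at hxk
        rw [sqBall, Set.mem_ofPred_eq, hsum, inv_pow, inv_mul_lt_iff₀ (by positivity), mul_one]
        exact hxk
      · rw [Set.mem_ofPred_eq, hsum, Real.sqrt_mul (by positivity), Real.sqrt_sq (by positivity)]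
        simp only [Pi.smul_apply, smul_eq_mul, mul_assoc, ← Finset.mul_sum]
        rw [abs_mul, abs_of_pos (by positivity : 0 < k⁻¹)]
        calc _ = k⁻¹ * (c * √(∑ t, x t ^ 2) * √(∑ t, v t ^ 2)) := by ring
          _ ≤ _ := by gcongr
    · right
      refine ⟨hx1, le_trans ?_ hx2⟩
      rw [Real.sqrt_one, mul_one]
      gcongr
      calc c' = c * k := by rw [hkdef]; field_simp
        _ ≤ _ := by gcongr
  have hDtop : volume D ≠ ∞ :=
    measure_ne_top_of_subset Set.inter_subset_left (volume_sqBall_ne_top 1)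
  have h := (measure_mono (μ := volume) hsub).trans (measure_union_le _ _)
  rw [Measure.addHaar_smul, Module.finrank_fin_fun, abs_of_nonneg (by positivity)] at h
  refine (le_two_mul_of_le_half_add hDtop (by positivity) hk h).trans ?_
  refine (mul_le_mul_right (volume_cap_le hn hc'.le one_pos hv) 2).trans_eq ?_
  rw [← mul_assoc, ← mul_assoc]
  norm_num

theorem isCodingEnsemble_uniformSphere (hP : 0 < P) :
    IsCodingEnsemble (fun n => uniformSphere n P) P where
  isSymmetricEnsemble := by
    filter_upwards [eventually_ge_atTop 1] with n hn
    exact isSymmetricEnsemble_uniformSphere (by omega) hP.le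
  tendsto_power := by
    intro η hη
    refine tendsto_const_nhds.congr' ?_
    filter_upwards [eventually_ge_atTop 1] with n hn
    have hn0 : (n : ℝ) ≠ 0 := by positivity
    symm
    refine measure_eq_zero_iff_ae_notMem.2 ?_
    filter_upwards [ae_uniformSphere_sum_sq (n := n) (by omega) hP.le] with x hx
    rw [hx, inv_mul_cancel_left₀ hn0]
    simpa using hη
  cap_le := by
    intro c' c hc' hc
    have hc0 : 0 < c := hc'.trans hc
    filter_upwards [eventually_pow_le_half (div_nonneg hc'.le hc0.le) ((div_lt_one hc0).2 hc),
      eventually_ge_atTop 1] with n hk hn1 v hv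
    have hn : n ≠ 0 := by omega
    have hV := Real.sqrt_pos.2 (sum_sq_pos hv)
    have hs : 0 < √(n * P) := Real.sqrt_pos.2 (by positivity)
    rw [uniformSphere_eq_map_radialProj hn, Measure.map_apply (by fun_prop)
      (measurableSet_le measurable_const (by fun_prop)), cond_apply (measurableSet_sqBall _),
      ENNReal.inv_mul_le_iff (volume_sqBall_pos one_pos).ne' (volume_sqBall_ne_top _)]
    refine (measure_mono ?_).trans ((volume_cone_le hn hc' hc hk hv).trans_eq (mul_comm _ _))
    rintro x ⟨hx1, hx2⟩
    refine ⟨hx1, ?_⟩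
    rw [Set.mem_preimage, Set.mem_ofPred_eq] at hx2
    rw [Set.mem_ofPred_eq]
    rcases eq_or_ne x 0 with rfl | hx0
    · simp
    have hpos := Real.sqrt_pos.2 (sum_sq_pos hx0)
    simp only [radialProj, Pi.smul_apply, smul_eq_mul, mul_assoc, ← Finset.mul_sum] at hx2
    rw [abs_mul, abs_of_pos (by positivity), div_mul_eq_mul_div, le_div_iff₀ hpos] at hx2
    refine le_of_mul_le_mul_left ?_ hs
    linarith

end Sphere

/-! ### The random coding bound for a threshold test. -/

section RandomCoding

variable {K n : ℕ}

@[fun_prop]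
theorem measurable_filterOutput (h : Fin (K + 1) → ℝ) :
    Measurable (filterOutput h : (Fin n → ℝ) → Fin n → ℝ) := by
  refine measurable_pi_lambda _ fun t => ?_
  simp only [filterOutput_eq]
  fun_prop

/-- Pairs of a codeword and a nonzero received word whose correlation exceeds the threshold `τ`
times the norm of the received word. -/
def correlated (n : ℕ) (τ : ℝ) : Set ((Fin n → ℝ) × (Fin n → ℝ)) :=
  {p | p.2 ≠ 0 ∧ τ * √(∑ t, p.2 t ^ 2) ≤ |∑ t, p.1 t * p.2 t|}

theorem measurableSet_correlated (τ : ℝ) : MeasurableSet (correlated n τ) := by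
  have h1 : MeasurableSet {p : (Fin n → ℝ) × (Fin n → ℝ) | p.2 ≠ 0} :=
    measurable_snd (measurableSet_singleton (0 : Fin n → ℝ)).compl
  have h2 : MeasurableSet {p : (Fin n → ℝ) × (Fin n → ℝ) |
      τ * √(∑ t, p.2 t ^ 2) ≤ |∑ t, p.1 t * p.2 t|} :=
    measurableSet_le (by fun_prop) (by fun_prop)
  exact h1.inter h2

theorem measurableSet_errorEvent {M : ℕ} (C : Fin M → Fin n → ℝ) (i : Fin M) :
    MeasurableSet (errorEvent C i) := by
  have : errorEvent C i = ⋃ j ∈ {j | j ≠ i}, {y | glrtMetric (C i) y ≤ glrtMetric (C j) y} := by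
    ext y; simp [errorEvent]
  rw [this]
  refine MeasurableSet.biUnion (Set.to_countable _) fun j _ => ?_
  unfold glrtMetric
  exact measurableSet_le (by fun_prop) (by fun_prop)

theorem channel_apply (h : Fin (K + 1) → ℝ) (σ : ℝ) (x : Fin n → ℝ) {S : Set (Fin n → ℝ)}
    (hS : MeasurableSet S) : channel h σ x S = noise n σ {w | filterOutput h x + w ∈ S} := by
  rw [channel, Measure.map_apply (by fun_prop) hS]
  rfl

/-- Probability that the transmitted word `x` is not correlated with the output. -/
noncomputable def missProb (h : Fin (K + 1) → ℝ) (σ τ : ℝ) (x : Fin n → ℝ) : ℝ≥0∞ :=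
  noise n σ {w | (x, filterOutput h x + w) ∉ correlated n τ}

/-- Probability that the word `x'` is correlated with the output for the input `x`. -/
noncomputable def falseAlarmProb (h : Fin (K + 1) → ℝ) (σ τ : ℝ) (x x' : Fin n → ℝ) : ℝ≥0∞ :=
  noise n σ {w | (x', filterOutput h x + w) ∈ correlated n τ}

/-- If the sent word passes the threshold, any competitor whose metric is at least as large passes
it too, ties included. -/
theorem channel_errorEvent_le {M : ℕ} (h : Fin (K + 1) → ℝ) (σ τ : ℝ) (C : Fin M → Fin n → ℝ)
    (i : Fin M) :
    channel h σ (C i) (errorEvent C i) ≤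
      missProb h σ τ (C i) + ∑ j ∈ Finset.univ.erase i, falseAlarmProb h σ τ (C i) (C j) := by
  rw [channel_apply h σ _ (measurableSet_errorEvent C i)]
  refine (measure_mono (t := {w | (C i, filterOutput h (C i) + w) ∉ correlated n τ} ∪
    ⋃ j ∈ Finset.univ.erase i, {w | (C j, filterOutput h (C i) + w) ∈ correlated n τ}) ?_).trans
    ((measure_union_le _ _).trans (add_le_add le_rfl (measure_biUnion_finset_le _ _)))
  rintro w ⟨j, hj, hle⟩
  by_cases hw : (C i, filterOutput h (C i) + w) ∈ correlated n τ
  · right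
    simp only [Set.mem_iUnion]
    exact ⟨j, by simpa using hj, hw.1, hw.2.trans hle⟩
  · exact Or.inl hw

theorem measurableSet_not_correlated (h : Fin (K + 1) → ℝ) (τ : ℝ) :
    MeasurableSet {p : (Fin n → ℝ) × (Fin n → ℝ) |
      (p.1, filterOutput h p.1 + p.2) ∉ correlated n τ} :=
  (measurableSet_correlated τ).compl.preimage
    (f := fun p : (Fin n → ℝ) × (Fin n → ℝ) => (p.1, filterOutput h p.1 + p.2)) (by fun_prop)

theorem measurable_missProb (h : Fin (K + 1) → ℝ) (σ τ : ℝ) :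
    Measurable (missProb h σ τ : (Fin n → ℝ) → ℝ≥0∞) :=
  measurable_measure_prodMk_left (measurableSet_not_correlated h τ)

theorem lintegral_missProb (μ : Measure (Fin n → ℝ)) (h : Fin (K + 1) → ℝ) (σ τ : ℝ) :
    ∫⁻ x, missProb h σ τ x ∂μ =
      μ.prod (noise n σ) {p | (p.1, filterOutput h p.1 + p.2) ∉ correlated n τ} :=
  (Measure.prod_apply (measurableSet_not_correlated h τ)).symm

variable {μ : Measure (Fin n → ℝ)} [IsProbabilityMeasure μ]

theorem measurable_falseAlarmProb (h : Fin (K + 1) → ℝ) (σ τ : ℝ) :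
    Measurable fun p : (Fin n → ℝ) × (Fin n → ℝ) => falseAlarmProb h σ τ p.1 p.2 := by
  have hS : MeasurableSet {q : ((Fin n → ℝ) × (Fin n → ℝ)) × (Fin n → ℝ) |
      (q.1.2, filterOutput h q.1.1 + q.2) ∈ correlated n τ} :=
    (measurableSet_correlated τ).preimage (by fun_prop)
  exact measurable_measure_prodMk_left hS

/-- By Tonelli, integrate over `x'` first: with `x` and the noise fixed, the output is a fixed
vector, to which the cap bound applies. -/
theorem lintegral_falseAlarmProb_le (h : Fin (K + 1) → ℝ) (σ τ : ℝ) {β : ℝ≥0∞}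
    (hβ : ∀ v : Fin n → ℝ, v ≠ 0 → μ {x | τ * √(∑ t, v t ^ 2) ≤ |∑ t, x t * v t|} ≤ β)
    (x : Fin n → ℝ) : ∫⁻ x', falseAlarmProb h σ τ x x' ∂μ ≤ β := by
  have hS : MeasurableSet {p : (Fin n → ℝ) × (Fin n → ℝ) |
      (p.1, filterOutput h x + p.2) ∈ correlated n τ} :=
    (measurableSet_correlated τ).preimage (by fun_prop)
  calc ∫⁻ x', falseAlarmProb h σ τ x x' ∂μ
      = μ.prod (noise n σ) {p | (p.1, filterOutput h x + p.2) ∈ correlated n τ} :=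
        (Measure.prod_apply hS).symm
    _ = ∫⁻ w, μ {x' | (x', filterOutput h x + w) ∈ correlated n τ} ∂noise n σ :=
        Measure.prod_apply_symm hS
    _ ≤ ∫⁻ _, β ∂noise n σ := by
        refine lintegral_mono fun w => ?_
        -- A zero output would let every word meet the threshold; `correlated` excludes it.
        by_cases hy : filterOutput h x + w = 0
        · simp [correlated, hy]
        · exact (measure_mono fun x' hx' => hx'.2).trans (hβ _ hy)
    _ = β := by simp

theorem lintegral_pi_falseAlarmProb_le (h : Fin (K + 1) → ℝ) (σ τ : ℝ) {β : ℝ≥0∞}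
    (hβ : ∀ v : Fin n → ℝ, v ≠ 0 → μ {x | τ * √(∑ t, v t ^ 2) ≤ |∑ t, x t * v t|} ≤ β) {M : ℕ}
    {i j : Fin M} (hij : i ≠ j) :
    ∫⁻ C : Fin M → Fin n → ℝ, falseAlarmProb h σ τ (C i) (C j) ∂(Measure.pi fun _ => μ) ≤ β := by
  have hind : IndepFun (fun C : Fin M → Fin n → ℝ => C i) (fun C => C j)
      (Measure.pi fun _ => μ) :=
    (iIndepFun_pi (μ := fun _ : Fin M => μ) (X := fun _ => id)
      fun _ => aemeasurable_id).indepFun hij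
  have hmap := hind.map_prod_eq_prod_map_map (measurable_pi_apply i).aemeasurable
    (measurable_pi_apply j).aemeasurable
  have hev : ∀ k : Fin M, (Measure.pi fun _ : Fin M => μ).map (fun C => C k) = μ :=
    fun k => (measurePreserving_eval (fun _ : Fin M => μ) k).map_eq
  rw [hev, hev] at hmap
  calc ∫⁻ C : Fin M → Fin n → ℝ, falseAlarmProb h σ τ (C i) (C j) ∂(Measure.pi fun _ => μ)
      = ∫⁻ p, falseAlarmProb h σ τ p.1 p.2 ∂(μ.prod μ) := by
        rw [← hmap, lintegral_map (measurable_falseAlarmProb h σ τ) (by fun_prop)]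
    _ = ∫⁻ x, ∫⁻ x', falseAlarmProb h σ τ x x' ∂μ ∂μ :=
        lintegral_prod _ (measurable_falseAlarmProb h σ τ).aemeasurable
    _ ≤ ∫⁻ _, β ∂μ := lintegral_mono fun x => lintegral_falseAlarmProb_le h σ τ hβ x
    _ = β := by simp

theorem measurable_missProb_eval (h : Fin (K + 1) → ℝ) (σ τ : ℝ) {M : ℕ} (i : Fin M) :
    Measurable fun C : Fin M → Fin n → ℝ => missProb h σ τ (C i) :=
  (measurable_missProb h σ τ).comp (measurable_pi_apply i)

theorem measurable_falseAlarmProb_eval (h : Fin (K + 1) → ℝ) (σ τ : ℝ) {M : ℕ} (i j : Fin M) :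
    Measurable fun C : Fin M → Fin n → ℝ => falseAlarmProb h σ τ (C i) (C j) :=
  (measurable_falseAlarmProb h σ τ).comp
    (f := fun C : Fin M → Fin n → ℝ => (C i, C j))
    ((measurable_pi_apply i).prodMk (measurable_pi_apply j))

/-- Union bound for the probability that the message `i` is decoded incorrectly. -/
noncomputable def unionBound (h : Fin (K + 1) → ℝ) (σ τ : ℝ) {M : ℕ} (i : Fin M)
    (C : Fin M → Fin n → ℝ) : ℝ≥0∞ :=
  missProb h σ τ (C i) + ∑ j ∈ Finset.univ.erase i, falseAlarmProb h σ τ (C i) (C j)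

theorem measurable_unionBound (h : Fin (K + 1) → ℝ) (σ τ : ℝ) {M : ℕ} (i : Fin M) :
    Measurable (unionBound h σ τ i : (Fin M → Fin n → ℝ) → ℝ≥0∞) :=
  (measurable_missProb_eval h σ τ i).add
    (Finset.measurable_sum _ fun j _ => measurable_falseAlarmProb_eval h σ τ i j)

theorem lintegral_unionBound_le (h : Fin (K + 1) → ℝ) (σ τ : ℝ) {β : ℝ≥0∞}
    (hβ : ∀ v : Fin n → ℝ, v ≠ 0 → μ {x | τ * √(∑ t, v t ^ 2) ≤ |∑ t, x t * v t|} ≤ β) {M : ℕ}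
    (i : Fin M) :
    ∫⁻ C, unionBound h σ τ i C ∂(Measure.pi fun _ => μ) ≤
      ∫⁻ x, missProb h σ τ x ∂μ + (M - 1 : ℕ) * β := by
  unfold unionBound
  rw [lintegral_add_left (measurable_missProb_eval h σ τ i),
    lintegral_finsetSum _ fun j _ => measurable_falseAlarmProb_eval h σ τ i j]
  refine add_le_add ?_ ?_
  · exact ((measurePreserving_eval (fun _ : Fin M => μ) i).lintegral_comp
      (measurable_missProb h σ τ)).le
  · calc _ ≤ ∑ j ∈ Finset.univ.erase i, β := Finset.sum_le_sum fun j hj =>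
          lintegral_pi_falseAlarmProb_le h σ τ hβ (Finset.ne_of_mem_erase hj).symm
      _ = (M - 1 : ℕ) * β := by simp [Finset.card_erase_of_mem]

/-- Random coding bound: the average error probability is at most the probability of a miss plus the
union bound over the false alarms. -/
theorem avgErrorProb_le (h : Fin (K + 1) → ℝ) (σ τ : ℝ) {β : ℝ≥0∞}
    (hβ : ∀ v : Fin n → ℝ, v ≠ 0 → μ {x | τ * √(∑ t, v t ^ 2) ≤ |∑ t, x t * v t|} ≤ β) (M : ℕ) :
    avgErrorProb h σ M μ ≤
      μ.prod (noise n σ) {p | (p.1, filterOutput h p.1 + p.2) ∉ correlated n τ} +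
        (M - 1 : ℕ) * β := by
  rw [← lintegral_missProb]
  calc avgErrorProb h σ M μ
      ≤ ∫⁻ C : Fin M → Fin n → ℝ, (M : ℝ≥0∞)⁻¹ * ∑ i, unionBound h σ τ i C
          ∂(Measure.pi fun _ => μ) := by
        refine lintegral_mono fun C => ?_
        exact mul_le_mul_right (Finset.sum_le_sum fun i _ => channel_errorEvent_le h σ τ C i) _
    _ = (M : ℝ≥0∞)⁻¹ * ∑ i : Fin M, ∫⁻ C : Fin M → Fin n → ℝ, unionBound h σ τ i C
          ∂(Measure.pi fun _ => μ) := by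
        rw [lintegral_const_mul _ (Finset.measurable_sum _ fun i _ =>
          measurable_unionBound h σ τ i),
          lintegral_finsetSum _ fun i _ => measurable_unionBound h σ τ i]
    _ ≤ (M : ℝ≥0∞)⁻¹ * ∑ i : Fin M, (∫⁻ x, missProb h σ τ x ∂μ + (M - 1 : ℕ) * β) :=
        mul_le_mul_right (Finset.sum_le_sum fun i _ => lintegral_unionBound_le h σ τ hβ i) _
    _ = ((M : ℝ≥0∞)⁻¹ * M) * (∫⁻ x, missProb h σ τ x ∂μ + (M - 1 : ℕ) * β) := by
        rw [Finset.sum_const, Finset.card_univ, Fintype.card_fin, nsmul_eq_mul, mul_assoc]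
    -- Only an inequality is claimed, which also covers `M = 0`.
    _ ≤ 1 * (∫⁻ x, missProb h σ τ x ∂μ + (M - 1 : ℕ) * β) :=
        mul_le_mul_left (ENNReal.inv_mul_le_one _) _
    _ = _ := one_mul _

end RandomCoding

/-! ### Choice of the threshold, and achievability. -/

section Limit

variable {K : ℕ} {μ : ∀ n, Measure (Fin n → ℝ)} {Q : ℝ}

/-- By `hc` the limits of the correlation and of the output power pass the test strictly. This is an
open condition, hence holds with probability tending to one; positive output power rules out a zero
output. -/
theorem IsCodingEnsemble.tendsto_miss (hμ : IsCodingEnsemble μ Q) (h : Fin (K + 1) → ℝ) {σ c : ℝ}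
    (hσ : 0 < σ) (hQ : 0 < Q)
    (hc : c * √Q * √((∑ i, h i ^ 2) * Q + σ ^ 2) < |h 0 * Q|) :
    Tendsto (fun n : ℕ => (μ n).prod (noise n σ)
      {p | (p.1, filterOutput h p.1 + p.2) ∉ correlated n (c * √(n * Q))}) atTop (𝓝 0) := by
  have hU : {q : ℝ × ℝ | 0 < q.2 ∧ c * √Q * √q.2 < |q.1|} ∈
      𝓝 (h 0 * Q, (∑ i, h i ^ 2) * Q + σ ^ 2) := by
    refine IsOpen.mem_nhds ?_ ⟨?_, hc⟩
    · have h2 : IsOpen {q : ℝ × ℝ | c * √Q * √q.2 < |q.1|} :=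
        isOpen_lt (by fun_prop) (by fun_prop)
      exact (isOpen_lt continuous_const continuous_snd).inter h2
    · have : 0 ≤ ∑ i, h i ^ 2 := Finset.sum_nonneg fun _ _ => sq_nonneg _
      dsimp only
      positivity
  have hlim := TendstoInProb.measure_compl_tendsto
    (tendstoInProb_correlation (σ := σ) h hQ.le hμ.isSymmetricEnsemble hμ.tendsto_power)
    (tendstoInProb_output_energy h hQ.le hμ.isSymmetricEnsemble hμ.tendsto_power) hU
  refine tendsto_zero_of_eventually_le hlim ?_
  filter_upwards [eventually_ge_atTop 1] with n hn
  have hn0 : (0 : ℝ) < n := by exact_mod_cast hn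
  refine measure_mono fun p hp hpU => hp ?_
  obtain ⟨hy, hcorr⟩ := hpU
  refine ⟨fun h0 => ?_, ?_⟩
  · have : ∀ t, filterOutput h p.1 t + p.2 t = 0 := fun t => congrFun h0 t
    simp [this] at hy
  · set y := filterOutput h p.1 + p.2 with hydef
    change c * √Q * √((n : ℝ)⁻¹ * ∑ t, y t ^ 2) < |(n : ℝ)⁻¹ * ∑ t, p.1 t * y t| at hcorr
    change c * √(n * Q) * √(∑ t, y t ^ 2) ≤ |∑ t, p.1 t * y t|
    rw [abs_mul, abs_of_pos (inv_pos.2 hn0), inv_mul_eq_div, inv_mul_eq_div, lt_div_iff₀ hn0,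
      Real.sqrt_div' _ hn0.le] at hcorr
    refine le_of_eq_of_le ?_ hcorr.le
    rw [Real.sqrt_mul hn0.le]
    have hs : √(n : ℝ) ≠ 0 := (Real.sqrt_pos.2 hn0).ne'
    field_simp
    rw [Real.sq_sqrt hn0.le]
    ring

theorem IsCodingEnsemble.tendsto_avgErrorProb (hμ : IsCodingEnsemble μ Q) (h : Fin (K + 1) → ℝ)
    {σ R : ℝ} (hσ : 0 < σ) (hQ : 0 < Q) (hR0 : 0 < R)
    (hR : Real.exp (2 * R) <
      1 + h 0 ^ 2 * Q / (((∑ i, h i ^ 2) - h 0 ^ 2) * Q + σ ^ 2)) :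
    Tendsto (fun n : ℕ => avgErrorProb h σ ⌈Real.exp (n * R)⌉₊ (μ n)) atTop (𝓝 0) := by
  have hH : h 0 ^ 2 ≤ ∑ i, h i ^ 2 :=
    Finset.single_le_sum (f := fun i => h i ^ 2) (fun _ _ => sq_nonneg _) (Finset.mem_univ 0)
  set D := ((∑ i, h i ^ 2) - h 0 ^ 2) * Q + σ ^ 2 with hD
  have hDpos : 0 < D := by
    have := mul_nonneg (sub_nonneg.2 hH) hQ.le
    positivity
  have hS : (∑ i, h i ^ 2) * Q + σ ^ 2 = D + h 0 ^ 2 * Q := by rw [hD]; ring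
  have hSpos : 0 < D + h 0 ^ 2 * Q := by positivity
  -- The rate condition rewritten as 1 - e^{-2R} < ρ².
  have hlt : 1 - (Real.exp (2 * R))⁻¹ < h 0 ^ 2 * Q / (D + h 0 ^ 2 * Q) := by
    have h1 : (1 + h 0 ^ 2 * Q / D)⁻¹ < (Real.exp (2 * R))⁻¹ :=
      inv_strictAnti₀ (Real.exp_pos _) hR
    have h2 : (1 + h 0 ^ 2 * Q / D)⁻¹ = 1 - h 0 ^ 2 * Q / (D + h 0 ^ 2 * Q) := by
      field_simp
      ring
    linarith
  -- Now 1 - e^{-2R} < u < v < ρ². The threshold √v is met by the sent word since v < ρ²; the cap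
  -- exponent uses √u < √v, and e^R √(1 - u) < 1. Positivity of u comes from R > 0.
  obtain ⟨v, hv1, hv2⟩ := exists_between hlt
  obtain ⟨u, hu1, hu2⟩ := exists_between hv1
  have hu0 : 0 < u := by
    have : (Real.exp (2 * R))⁻¹ < 1 := inv_lt_one_of_one_lt₀ (Real.one_lt_exp_iff.2 (by linarith))
    linarith
  have hv0 : 0 < v := hu0.trans hu2
  have hmiss := hμ.tendsto_miss h (c := √v) hσ hQ (by
    rw [hS, ← Real.sqrt_mul hv0.le, ← Real.sqrt_mul (by positivity), ← Real.sqrt_sq_eq_abs]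
    refine Real.sqrt_lt_sqrt (by positivity) ?_
    rw [lt_div_iff₀ hSpos] at hv2
    nlinarith)
  have hbase : Real.exp R * √(1 - u) < 1 := by
    have h1 : √(1 - u) < √((Real.exp R)⁻¹ ^ 2) := by
      refine (Real.sqrt_lt_sqrt_iff_of_pos (by positivity)).2 ?_
      rw [inv_pow, ← Real.exp_nat_mul]
      push_cast
      linarith
    rw [Real.sqrt_sq (by positivity)] at h1
    calc _ < Real.exp R * (Real.exp R)⁻¹ := by gcongr
      _ = 1 := mul_inv_cancel₀ (Real.exp_pos _).ne'
  have hpow : Tendsto (fun n : ℕ => 4 * ENNReal.ofReal ((Real.exp R * √(1 - u)) ^ n)) atTop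
      (𝓝 0) := by
    have h1 := (ENNReal.continuous_ofReal.tendsto 0).comp
      (tendsto_pow_atTop_nhds_zero_of_lt_one (by positivity) hbase)
    simpa using ENNReal.Tendsto.const_mul h1 (a := 4) (Or.inr (by simp))
  have hsum := hmiss.add hpow
  rw [add_zero] at hsum
  refine tendsto_zero_of_eventually_le hsum ?_
  filter_upwards [hμ.isSymmetricEnsemble, hμ.cap_le √u √v (Real.sqrt_pos.2 hu0)
    (Real.sqrt_lt_sqrt hu0.le hu2)] with n hn hcap
  have := hn.isProbabilityMeasure
  refine (avgErrorProb_le h σ (√v * √(n * Q)) hcap _).trans (add_le_add le_rfl ?_)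
  rw [Real.sq_sqrt hu0.le, mul_left_comm, mul_pow, ENNReal.ofReal_mul (by positivity)]
  gcongr
  -- Only M - 1 codewords compete, which absorbs the rounding up.
  have hM : ((⌈Real.exp (n * R)⌉₊ - 1 : ℕ) : ℝ) ≤ Real.exp R ^ n := by
    rw [← Real.exp_nat_mul]
    have h1 : 1 ≤ ⌈Real.exp (n * R)⌉₊ := Nat.one_le_ceil_iff.2 (Real.exp_pos _)
    rw [Nat.cast_sub h1, Nat.cast_one]
    linarith [Nat.ceil_lt_add_one (Real.exp_pos (n * R)).le]
  rw [← ENNReal.ofReal_natCast]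
  exact ENNReal.ofReal_le_ofReal hM

theorem avgErrorProb_one {n : ℕ} (h : Fin (K + 1) → ℝ) (σ : ℝ) (ν : Measure (Fin n → ℝ)) :
    avgErrorProb h σ 1 ν = 0 := by
  have : ∀ (C : Fin 1 → Fin n → ℝ) i, errorEvent C i = ∅ := fun C i => by
    ext y
    simp [errorEvent, Subsingleton.elim _ i]
  simp [avgErrorProb, errorProb, this]

theorem exp_two_mul_lt_of_lt_half_log {R a : ℝ} (ha : 0 ≤ a) (hR : R < 1 / 2 * Real.log (1 + a)) :
    Real.exp (2 * R) < 1 + a := by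
  rw [← Real.lt_log_iff_exp_lt (by linarith)]
  linarith

/-- The signal to interference and noise ratio increases with the power. -/
theorem sinr_mono {a b s P Q : ℝ} (ha : 0 ≤ a) (hb : 0 ≤ b) (hs : 0 < s) (hP : 0 < P)
    (hPQ : P ≤ Q) : a * P / (b * P + s) ≤ a * Q / (b * Q + s) := by
  have hQ : 0 < Q := hP.trans_le hPQ
  rw [div_le_div_iff₀ (by positivity) (by positivity)]
  nlinarith [mul_nonneg (mul_nonneg ha hs.le) (sub_nonneg.2 hPQ)]

/-- Random coding achieves every rate below the mutual information of the memoryless Gaussian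
channel in which the intersymbol interference is regarded as noise. -/
theorem IsCodingEnsemble.tendsto_avgErrorProb_of_lt (hμ : IsCodingEnsemble μ Q)
    (h : Fin (K + 1) → ℝ) {σ P R : ℝ} (hσ : 0 < σ) (hP : 0 < P) (hPQ : P ≤ Q)
    (hR : R < 1 / 2 * Real.log (1 + h 0 ^ 2 * P / (((∑ i, h i ^ 2) - h 0 ^ 2) * P + σ ^ 2))) :
    Tendsto (fun n : ℕ => avgErrorProb h σ ⌈Real.exp (n * R)⌉₊ (μ n)) atTop (𝓝 0) := by
  have hH : 0 ≤ (∑ i, h i ^ 2) - h 0 ^ 2 := sub_nonneg.2 <|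
    Finset.single_le_sum (f := fun i => h i ^ 2) (fun _ _ => sq_nonneg _) (Finset.mem_univ 0)
  -- For R ≤ 0 the code has a single word and never errs.
  rcases le_or_gt R 0 with hR0 | hR0
  · have hM : ∀ n : ℕ, ⌈Real.exp (n * R)⌉₊ = 1 := fun n => by
      refine le_antisymm (Nat.ceil_le.2 ?_) (Nat.one_le_ceil_iff.2 (Real.exp_pos _))
      rw [Nat.cast_one, Real.exp_le_one_iff]
      exact mul_nonpos_of_nonneg_of_nonpos (by positivity) hR0
    simp only [hM, avgErrorProb_one]
    exact tendsto_const_nhds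
  · refine hμ.tendsto_avgErrorProb h hσ (hP.trans_le hPQ) hR0 ?_
    refine (exp_two_mul_lt_of_lt_half_log (by positivity) hR).trans_le ?_
    linarith [sinr_mono (sq_nonneg (h 0)) hH (sq_pos_of_pos hσ) hP hPQ]

/-- Some code in the support of the ensemble is almost as good as the average. -/
theorem exists_code_errorProb_lt {n M : ℕ} {ν : Measure (Fin n → ℝ)} [IsProbabilityMeasure ν]
    (h : Fin (K + 1) → ℝ) (σ : ℝ) {p : (Fin n → ℝ) → Prop} (hp : ∀ᵐ x ∂ν, p x) {a : ℝ≥0∞}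
    (ha : avgErrorProb h σ M ν < a) :
    ∃ C : Fin M → Fin n → ℝ, (∀ i, p (C i)) ∧ errorProb h σ C < a := by
  by_contra! hcon
  have hall : ∀ᵐ C ∂(Measure.pi fun _ : Fin M => ν), ∀ i, p (C i) :=
    ae_all_iff.2 fun i => (Measure.quasiMeasurePreserving_eval (fun _ : Fin M => ν) i).ae hp
  refine ha.not_ge ?_
  calc a = ∫⁻ _ : Fin M → Fin n → ℝ, a ∂(Measure.pi fun _ => ν) := by simp
    _ ≤ avgErrorProb h σ M ν := lintegral_mono_ae (hall.mono fun C hC => hcon C hC)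

theorem isAchievable_of_tendsto_avgErrorProb (h : Fin (K + 1) → ℝ) {σ P R : ℝ} (hP : 0 ≤ P)
    (hlim : Tendsto (fun n : ℕ => avgErrorProb h σ ⌈Real.exp (n * R)⌉₊ (uniformSphere n P)) atTop
      (𝓝 0)) : IsAchievable h σ P R := by
  intro δ hδ
  -- The slack 1/n supplies the strict inequality needed to extract a code below the average. For n
  -- = 0 or an infinite average the zero code keeps the power constraint, and such n do not affect
  -- the limit.
  have hex : ∀ n : ℕ, ∃ C : Fin ⌈Real.exp (n * R)⌉₊ → Fin n → ℝ,
      (∀ i, ∑ t, C i t ^ 2 ≤ n * P) ∧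
      (n ≠ 0 → avgErrorProb h σ ⌈Real.exp (n * R)⌉₊ (uniformSphere n P) ≠ ∞ →
        errorProb h σ C ≤
        avgErrorProb h σ ⌈Real.exp (n * R)⌉₊ (uniformSphere n P) + (n : ℝ≥0∞)⁻¹) := fun n => by
    by_cases hn : n ≠ 0 ∧ avgErrorProb h σ ⌈Real.exp (n * R)⌉₊ (uniformSphere n P) ≠ ∞
    · have := (isSymmetricEnsemble_uniformSphere hn.1 hP).isProbabilityMeasure
      obtain ⟨C, hC, hCe⟩ := exists_code_errorProb_lt h σ (ae_uniformSphere_sum_sq hn.1 hP)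
        (ENNReal.lt_add_right hn.2 (ENNReal.inv_ne_zero.2 (ENNReal.natCast_ne_top n)))
      exact ⟨C, fun i => (hC i).le, fun _ _ => hCe.le⟩
    · refine ⟨0, fun i => ?_, fun h1 h2 => absurd ⟨h1, h2⟩ hn⟩
      simp only [Pi.zero_apply, ne_eq, OfNat.ofNat_ne_zero, not_false_eq_true, zero_pow,
        Finset.sum_const_zero]
      positivity
  choose C hC hCe using hex
  refine ⟨fun n => ⌈Real.exp (n * R)⌉₊, C, fun n => ?_, hC, ?_⟩
  · refine le_trans (Real.exp_le_exp.2 ?_) (Nat.le_ceil _)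
    gcongr
    linarith
  · have hsum := hlim.add ENNReal.tendsto_inv_nat_nhds_zero
    rw [add_zero] at hsum
    refine tendsto_zero_of_eventually_le hsum ?_
    filter_upwards [eventually_ge_atTop 1, hlim.eventually_lt_const ENNReal.zero_lt_top]
      with n hn hfin
    exact hCe n (by omega) hfin.ne

end Limit

end GaussianISI

theorem theorem4 {K : ℕ} (h : Fin (K + 1) → ℝ) (σ P : ℝ) (hσ : 0 < σ) (hP : 0 < P) (R : ℝ)
    (hR : R < 1 / 2 * Real.log (1 + h 0 ^ 2 * P / (((∑ i, h i ^ 2) - h 0 ^ 2) * P + σ ^ 2))) :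
    GaussianISI.IsAchievable h σ P R ∧
    (∀ ε : ℝ, 0 < ε →
      Tendsto (fun n : ℕ => GaussianISI.avgErrorProb h σ ⌈Real.exp (n * R)⌉₊
        (GaussianISI.uniformShell n P ε)) atTop (𝓝 0)) ∧
    Tendsto (fun n : ℕ => GaussianISI.avgErrorProb h σ ⌈Real.exp (n * R)⌉₊
      (GaussianISI.uniformSphere n P)) atTop (𝓝 0) := by
  have hsphere := (GaussianISI.isCodingEnsemble_uniformSphere hP).tendsto_avgErrorProb_of_lt h
    hσ hP le_rfl hR
  exact ⟨GaussianISI.isAchievable_of_tendsto_avgErrorProb h hP.le hsphere, fun ε hε =>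
    (GaussianISI.isCodingEnsemble_uniformShell hP hε).tendsto_avgErrorProb_of_lt h hσ hP
      (le_add_of_nonneg_right hε.le) hR, hsphere⟩
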